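/- **Setting.** $U$ is a finite set of $n$ items with weights $w:U\to[0,\infty)$, and $W=\sum_{a\in U}w(a)>0$. An algorithm knows $n$. It can take a *proportional* sample (the answer is $(a,w(a))$ with probability $w(a)/W$) or a *uniform* sample (the answer is $(a,w(a))$ with probability $1/n$), test two items for equality, and use internal randomness. All samples are independent. A $(1\pm\varepsilon)$-approximation of $x$ is a value in $[(1-\varepsilon)x,(1+\varepsilon)x]$. **Order.** Items are ordered by weight. Ties are broken by uniformly random, pairwise distinct ranks from $\{0,\dots,n-1\}$, drawn independently of the samples when an item is first seen and then remembered. For a threshold item $\theta$ (identified with its weight in formulas), an item is *heavy* if it is $\ge\theta$ in this order. If the weights are distinct, this means $w(a)\ge w(\theta)$. **Subroutines.** "With success probability $q$" means: return the median of $2\lceil 4/(1-q)\rceil+1$ independent runs. * $\mathrm{BernoulliEstimator}(X,\varepsilon)$: repeat the experiment $X$ until it has succeeded $r=\lceil 12/\varepsilon^2\rceil$ times, and return $r/N$, where $N$ is the number of trials. * $\mathrm{PropEstimator}(\tilde n,\varepsilon)$: take $m=\lceil\sqrt{24\tilde n}/\varepsilon\rceil+1$ samples. With $c_s$ the number of occurrences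 of $s$, return $\binom m2\big(\sum_s \binom{c_s}{2}/w(s)\big)^{-1}$ (which is $\infty$ if no item repeats). * $\mathrm{HarmonicEstimator}(\varepsilon,\tilde\theta,\phi)$: let $\hat p$ be the output of $\mathrm{BernoulliEstimator}(\text{a uniform sample is}\ \ge\phi,\ \varepsilon/3)$ with success probability $9/10$. Take $k=\lceil 45\,\tilde\theta/(\phi(1-\varepsilon/3)\hat p\,\varepsilon^2)\rceil$ proportional samples $a_1,\dots,a_k$, let $H$ be the average of the $b_i$, where $b_i=1/w(a_i)$ if $a_i\ge\phi$ and $b_i=0$ otherwise, and return $\hat p/H$. **$\mathrm{HybridEstimator}(n,\varepsilon)$** (with a constant $C$). Abort if more than $C\,n^{1/3}/\varepsilon^{4/3}$ samples are needed. Otherwise: 1. Let $\theta$ be the $180$-th largest of $\lceil 120\,n^{1/3}\varepsilon^{2/3}\rceil$ uniform samples (counted with multiplicity). 2. Let $\hat p$ be the output of $\mathrm{BernoulliEstimator}(\text{a proportional sample is heavy},\ \varepsilon/3)$ with success probability $19/20$. 3. If $\hat p\ge 1/2$: run $\mathrm{PropEstimator}(2n^{2/3}/\varepsilon^{2/3},\varepsilon/3)$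 with success probability $19/20$ on proportional samples conditioned on being heavy, obtained by rejecting the samples that are not heavy; divide its output by $\hat p$ and return the result. 4. If $\hat p<1/2$: run $\mathrm{HarmonicEstimator}(\varepsilon,3\theta,\theta)$ with success probability $19/20$, multiply its output by $n$, and return the result. **Theorem.** There is an absolute constant $C_0>0$ such that for every $C\ge C_0$, every such $(U,w)$ with $|U|=n$, and every $\varepsilon$ with $8/\sqrt n\le\varepsilon<1$: $\mathrm{HybridEstimator}(n,\varepsilon)$ with constant $C$ never uses more than $C\,n^{1/3}/\varepsilon^{4/3}$ samples, and with probability at least $2/3$ it does not abort and returns a $(1\pm\varepsilon)$-approximation of $W$. -/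

import Mathlib

open scoped NNReal ENNReal

namespace HybridSampling

/-- Sampling algorithms in the hybrid setting, as decision trees: `I` is the type of answers to a
sampling query, `α` the type of outputs. An algorithm returns a value, aborts, takes one
proportional sample, takes one uniform sample, or draws a natural number from a law of its own
(internal randomness, which costs no sample), and goes on depending on the answer. It knows the
universe and the weights only through the answers. -/
inductive Alg (I : Type*) (α : Type*)
  | ret (x : α)
  | abort
  | prop (k : I → Alg I α)
  | unif (k : I → Alg I α)
  | coin (μ : PMF ℕ) (k : ℕ → Alg I α)

namespace Alg

/-- Run `A`, then continue with its output. -/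
def bind {I α β : Type*} : Alg I α → (α → Alg I β) → Alg I β
  | ret x, f => f x
  | abort, _ => abort
  | prop k, f => prop fun a => (k a).bind f
  | unif k, f => unif fun a => (k a).bind f
  | coin μ k, f => coin μ fun c => (k c).bind f

/-- One proportional sample. -/
def propSample {I : Type*} : Alg I I := prop ret

/-- One uniform sample. -/
def unifSample {I : Type*} : Alg I I := unif ret

/-- `m` independent runs of `A`, and the list of their outputs. -/
def replicate {I α : Type*} (A : Alg I α) : ℕ → Alg I (List α)
  | 0 => ret []
  | m + 1 => A.bind fun x => (replicate A m).bind fun l => ret (x :: l)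

/-- Abort as soon as `A` asks for more than `B` samples. -/
def withBudget {I α : Type*} : Alg I α → ℕ → Alg I α
  | ret x, _ => ret x
  | abort, _ => abort
  | prop _, 0 => abort
  | prop k, B + 1 => prop fun a => (k a).withBudget B
  | unif _, 0 => abort
  | unif k, B + 1 => unif fun a => (k a).withBudget B
  | coin μ k, B => coin μ fun c => (k c).withBudget B

end Alg

/-! ### The law of a run on an instance `(U, w)` -/

section Semantics

variable {U : Type*} [Fintype U]

/-- Proportional sampling: `a` has probability `w a / W`, where `W = ∑ a, w a`. -/
noncomputable def propDist (w : U → ℝ≥0) (hW : ∑ a, w a ≠ 0) : PMF U :=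
  PMF.ofFintype (fun a => ((w a / ∑ b, w b : ℝ≥0) : ℝ≥0∞)) (by
    rw [← ENNReal.ofNNReal_finsetSum, ← Finset.sum_div, div_self hW, ENNReal.coe_one])

/-- The joint law of the output (`none` if the algorithm aborts) and of the number of samples
taken, when `Alg` is run on the instance `(U, w)`. A sample of the item `a` is answered by
`(a, w a)`. -/
noncomputable def run [Nonempty U] (w : U → ℝ≥0) (hW : ∑ a, w a ≠ 0) {α : Type*} :
    Alg (U × ℝ≥0) α → PMF (Option α × ℕ)
  | .ret x => PMF.pure (some x, 0)
  | .abort => PMF.pure (none, 0)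
  | .prop k => (propDist w hW).bind fun a =>
      (run w hW (k (a, w a))).map fun y => (y.1, y.2 + 1)
  | .unif k => (PMF.uniformOfFintype U).bind fun a =>
      (run w hW (k (a, w a))).map fun y => (y.1, y.2 + 1)
  | .coin μ k => μ.bind fun c => run w hW (k c)

end Semantics

/-- `x` is a `(1 ± ε)`-approximation of `W`. -/
def IsApprox (ε : ℝ) (W : ℝ≥0) (x : ℝ≥0∞) : Prop :=
  ENNReal.ofReal ((1 - ε) * W) ≤ x ∧ x ≤ ENNReal.ofReal ((1 + ε) * W)

/-! ### Breaking ties between items of equal weight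

Every item that is seen gets a rank in `{0, …, n - 1}`. The ranks are uniformly random and pairwise
distinct; they are drawn when an item is seen for the first time, and remembered, so that only
equality tests between items are needed. -/

/-- A sampled item, with its weight and its rank. -/
structure Item (U : Type*) where
  item : U
  weight : ℝ≥0
  rank : ℕ

/-- Items are ordered by weight, and items of equal weight by rank. -/
abbrev Key := ℝ≥0 ×ₗ ℕ

/-- The position of an item in the order. -/
def Item.key {U : Type*} (x : Item U) : Key := toLex (x.weight, x.rank)

/-- The weight that belongs to a key. -/
def Key.weight (θ : Key) : ℝ≥0 := (ofLex θ).1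

/-- A uniformly random element of `{0, …, n - 1}` that the table `T` does not use yet. (There is
one whenever `T` holds fewer than `n` items.) -/
noncomputable def freshRank {U : Type*} (n : ℕ) (T : List (U × ℕ)) : PMF ℕ :=
  if h : (Finset.range n \ (T.map Prod.snd).toFinset).Nonempty then PMF.uniformOfFinset _ h
  else PMF.pure 0

/-- Look up the rank of `a` in the table `T`, or draw it and store it, then continue. -/
noncomputable def withRank {U : Type*} [DecidableEq U] {I α : Type*} (n : ℕ) (T : List (U × ℕ))
    (a : U) (k : ℕ → List (U × ℕ) → Alg I α) : Alg I α :=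
  match T.lookup a with
  | some r => k r T
  | none => .coin (freshRank n T) fun r => k r ((a, r) :: T)

/-- Run an algorithm that works with ranks on answers without ranks; `T` is the table of the ranks
assigned so far. -/
noncomputable def attachRanks {U : Type*} [DecidableEq U] {α : Type*} (n : ℕ) :
    Alg (Item U) α → List (U × ℕ) → Alg (U × ℝ≥0) α
  | .ret x, _ => .ret x
  | .abort, _ => .abort
  | .prop k, T => .prop fun a => withRank n T a.1 fun r T' => attachRanks n (k ⟨a.1, a.2, r⟩) T'
  | .unif k, T => .unif fun a => withRank n T a.1 fun r T' => attachRanks n (k ⟨a.1, a.2, r⟩) T'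
  | .coin μ k, T => .coin μ fun c => attachRanks n (k c) T

/-! ### Subroutines

Loops take a bound `fuel` on their number of rounds and abort beyond it. Each round takes a sample,
and `fuel` will be the total number of samples after which the main algorithm aborts anyway. -/

/-- The `k`-th largest entry of a list (counted from `1`, with multiplicity). -/
noncomputable def kthLargest {α : Type*} [LinearOrder α] [OrderBot α] (k : ℕ) (l : List α) : α :=
  (l.insertionSort (· ≥ ·)).getD (k - 1) ⊥

/-- The median of a list of odd length. -/
noncomputable def median {α : Type*} [LinearOrder α] [OrderBot α] (l : List α) : α :=
  kthLargest ((l.length + 1) / 2) l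

/-- Probability amplification: the median of sufficiently many (an odd number of) independent runs
of an estimator that succeeds with probability `2 / 3` succeeds with probability `q`. -/
noncomputable def amplify {I α : Type*} [LinearOrder α] [OrderBot α] (q : ℝ) (A : Alg I α) :
    Alg I α :=
  (A.replicate (2 * ⌈4 / (1 - q)⌉₊ + 1)).bind fun l => .ret (median l)

/-- Repeat the experiment `X` until it has succeeded `r` times, and return the number of trials. -/
def trials {I : Type*} (X : Alg I Bool) : (fuel r : ℕ) → Alg I ℕ
  | _, 0 => .ret 0
  | 0, _ + 1 => .abort
  | fuel + 1, r + 1 => X.bind fun b =>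
      (trials X fuel (if b then r else r + 1)).bind fun N => .ret (N + 1)

/-- Repeat `X` until its output is good, and return that output. -/
def repeatUntil {I α : Type*} (good : α → Prop) [DecidablePred good] (X : Alg I α) :
    (fuel : ℕ) → Alg I α
  | 0 => .abort
  | fuel + 1 => X.bind fun x => if good x then .ret x else repeatUntil good X fuel

/-- `BernoulliEstimator`: estimate the success probability `p` of `X` by inverse sampling. If `N`
trials are made until the `r`-th success, where `r = ⌈12 / ε ^ 2⌉`, then the estimate is `r / N`. -/
noncomputable def bernoulliEstimator {I : Type*} (fuel : ℕ) (X : Alg I Bool) (ε : ℝ) : Alg I ℝ≥0 :=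
  (trials X fuel ⌈12 / ε ^ 2⌉₊).bind fun N => .ret ((⌈12 / ε ^ 2⌉₊ : ℝ≥0) / (N : ℝ≥0))

/-- `PropEstimator`, with samples drawn by `X`: from `m` samples, among which the item `s` occurs
`c_s` times, compute `(m choose 2) / ∑ s, (c_s choose 2) / w s`, which is `∞` if there is no
repetition. -/
noncomputable def propEstimator {U I : Type*} [DecidableEq U] (X : Alg I (Item U)) (n' ε : ℝ) :
    Alg I ℝ≥0∞ :=
  let m : ℕ := ⌈√(24 * n') / ε⌉₊ + 1
  (X.replicate m).bind fun l =>
    let S : List (U × ℝ≥0) := l.map fun x => (x.item, x.weight)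
    .ret ((m.choose 2 : ℝ≥0∞) / ∑ s ∈ S.toFinset, ((S.count s).choose 2 : ℝ≥0∞) / (s.2 : ℝ≥0∞))

/-- `HarmonicEstimator`, which estimates `W / n`: the items at or above `φ` in the order are the
heavy ones, and `θ'` is the advice on `W / n`. -/
noncomputable def harmonicEstimator {U : Type*} (fuel : ℕ) (ε : ℝ) (θ' : ℝ≥0) (φ : Key) :
    Alg (Item U) ℝ≥0∞ :=
  (amplify (9 / 10) (bernoulliEstimator fuel
    (Alg.unifSample.bind fun a => .ret (decide (φ ≤ a.key))) (ε / 3))).bind fun p =>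
  let k : ℕ := ⌈45 * (θ' : ℝ) / ((φ.weight : ℝ) * (1 - ε / 3) * p * ε ^ 2)⌉₊
  (Alg.propSample.replicate k).bind fun l =>
    let b : List ℝ≥0∞ := l.map fun a => if φ ≤ a.key then (a.weight : ℝ≥0∞)⁻¹ else 0
    let H : ℝ≥0∞ := b.sum / (k : ℝ≥0∞)
    .ret ((p : ℝ≥0∞) / H)

/-- The empirical quantile: the `180`-th largest of `120 n^(1/3) ε^(2/3)` uniform samples. -/
noncomputable def findThreshold {U : Type*} (n : ℕ) (ε : ℝ) : Alg (Item U) Key :=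
  (Alg.unifSample.replicate ⌈120 * (n : ℝ) ^ (1 / 3 : ℝ) * ε ^ (2 / 3 : ℝ)⌉₊).bind fun l =>
    .ret (kthLargest 180 (l.map Item.key))

/-- `HybridEstimator` for items with ranks, without the rule on aborting. -/
noncomputable def hybridCore {U : Type*} [DecidableEq U] (fuel n : ℕ) (ε : ℝ) :
    Alg (Item U) ℝ≥0∞ :=
  (findThreshold n ε).bind fun θ =>
  (amplify (19 / 20) (bernoulliEstimator fuel
    (Alg.propSample.bind fun a => .ret (decide (θ ≤ a.key))) (ε / 3))).bind fun p =>
  if (1 / 2 : ℝ≥0) ≤ p then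
    (amplify (19 / 20) (propEstimator
      (repeatUntil (fun a : Item U => θ ≤ a.key) Alg.propSample fuel)
      (2 * ((n : ℝ) ^ (2 / 3 : ℝ) / ε ^ (2 / 3 : ℝ))) (ε / 3))).bind fun Wθ =>
    .ret (Wθ / (p : ℝ≥0∞))
  else
    (amplify (19 / 20) (harmonicEstimator fuel ε (3 * θ.weight) θ)).bind fun ρ =>
    .ret ((n : ℝ≥0∞) * ρ)

/-- `HybridEstimator(n, ε)`, which aborts if it uses more than `C n^(1/3) / ε^(4/3)` samples. -/
noncomputable def hybridEstimator (U : Type*) [DecidableEq U] (C : ℝ) (n : ℕ) (ε : ℝ) :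
    Alg (U × ℝ≥0) ℝ≥0∞ :=
  let B : ℕ := ⌊C * ((n : ℝ) ^ (1 / 3 : ℝ) / ε ^ (4 / 3 : ℝ))⌋₊
  (attachRanks n (hybridCore B n ε) []).withBudget B

end HybridSampling

/-!
Drawing the rank of an item when it is first seen gives the same law as drawing all ranks in
advance, so one may argue for a fixed injective assignment of ranks, for which the order of the
items is strict.

The threshold `θ` is an empirical quantile, and a Chernoff bound shows that between `h / 2` and
`4 h` items are heavy, where `h = n^(2/3) / ε^(2/3)`. At most `n * w θ` of the total weight `W` is
light, so the fraction `p` of `W` carried by the heavy items is at least their share of the items,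
of order `n^(-1/3) ε^(-2/3)`; inverse sampling therefore estimates `p` up to `1 ± ε / 6` with
`O(n^(1/3) / ε^(4/3))` samples. If the estimate is at least `1 / 2`, a heavy proportional sample
costs only `O(1)` samples, and collisions among `O(√h / ε) = O(n^(1/3) / ε^(4/3))` of them give the
weight of the heavy items, which is divided by `p`. Otherwise `p` is bounded away from `1`, and
`(1 - p) W ≤ n * w θ` yields `W ≤ 3 n * w θ`. This bounds the variance of the reciprocal weights of
heavy proportional samples, whose mean is the number of heavy items divided by `W`.

Each estimator succeeds with constant probability by Chebyshev's inequality, and medians of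
independent runs raise this probability. The sample costs are bounded by the inequalities of Markov
and Chebyshev, so aborting is one more unlikely event in a union bound.
-/

namespace HybridSampling

/-! ### Expectations over the runs of an algorithm -/

section Expect

variable {I α β : Type*} (P Q : PMF I)

/-- The expectation of `g`, a function of the output (`none` if the algorithm aborts) and of the
number of samples, when the answers to proportional samples have law `P` and those to uniform
samples have law `Q`. -/
noncomputable def expect (P Q : PMF I) : Alg I α → (Option α → ℕ → ℝ≥0∞) → ℝ≥0∞
  | .ret x, g => g (some x) 0
  | .abort, g => g none 0
  | .prop k, g => ∑' a, P a * expect P Q (k a) fun o c => g o (c + 1)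
  | .unif k, g => ∑' a, Q a * expect P Q (k a) fun o c => g o (c + 1)
  | .coin μ k, g => ∑' c, μ c * expect P Q (k c) g

theorem expect_mono (A : Alg I α) {g g' : Option α → ℕ → ℝ≥0∞} (h : ∀ o c, g o c ≤ g' o c) :
    expect P Q A g ≤ expect P Q A g' := by
  induction A generalizing g g' with
  | ret x => exact h _ _
  | abort => exact h _ _
  | prop k ih => exact ENNReal.tsum_le_tsum fun a => by gcongr; exact ih _ fun o c => h o _
  | unif k ih => exact ENNReal.tsum_le_tsum fun a => by gcongr; exact ih _ fun o c => h o _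
  | coin μ k ih => exact ENNReal.tsum_le_tsum fun c => by gcongr; exact ih _ h

theorem expect_add (A : Alg I α) (g g' : Option α → ℕ → ℝ≥0∞) :
    expect P Q A (fun o c => g o c + g' o c) = expect P Q A g + expect P Q A g' := by
  induction A generalizing g g' with
  | ret x => rfl
  | abort => rfl
  | prop k ih => simp only [expect, ih, mul_add, ENNReal.tsum_add]
  | unif k ih => simp only [expect, ih, mul_add, ENNReal.tsum_add]
  | coin μ k ih => simp only [expect, ih, mul_add, ENNReal.tsum_add]

theorem expect_mul_left (A : Alg I α) (r : ℝ≥0∞) (g : Option α → ℕ → ℝ≥0∞) :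
    expect P Q A (fun o c => r * g o c) = r * expect P Q A g := by
  induction A generalizing g with
  | ret x => rfl
  | abort => rfl
  | prop k ih => simp only [expect, ih, mul_left_comm _ r, ENNReal.tsum_mul_left]
  | unif k ih => simp only [expect, ih, mul_left_comm _ r, ENNReal.tsum_mul_left]
  | coin μ k ih => simp only [expect, ih, mul_left_comm _ r, ENNReal.tsum_mul_left]

theorem expect_const (A : Alg I α) (r : ℝ≥0∞) : expect P Q A (fun _ _ => r) = r := by
  induction A with
  | ret x => rfl
  | abort => rfl
  | prop k ih => simp only [expect, ih, ENNReal.tsum_mul_right, PMF.tsum_coe, one_mul]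
  | unif k ih => simp only [expect, ih, ENNReal.tsum_mul_right, PMF.tsum_coe, one_mul]
  | coin μ k ih => simp only [expect, ih, ENNReal.tsum_mul_right, PMF.tsum_coe, one_mul]

theorem expect_bind (A : Alg I α) (f : α → Alg I β) (g : Option β → ℕ → ℝ≥0∞) :
    expect P Q (A.bind f) g = expect P Q A fun o c =>
      o.elim (g none c) fun x => expect P Q (f x) fun o' d => g o' (c + d) := by
  induction A generalizing g with
  | ret x => simp only [Alg.bind, expect, Option.elim, zero_add]
  | abort => rfl
  | prop k ih => simp only [Alg.bind, expect, ih, add_right_comm]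
  | unif k ih => simp only [Alg.bind, expect, ih, add_right_comm]
  | coin μ k ih => simp only [Alg.bind, expect, ih]

theorem expect_withBudget (A : Alg I α) (B : ℕ) (g : α → ℝ≥0∞) :
    expect P Q (A.withBudget B) (fun o _ => o.elim 0 g) =
      expect P Q A fun o c => if c ≤ B then o.elim 0 g else 0 := by
  induction A generalizing B with
  | ret x => simp [Alg.withBudget, expect]
  | abort => simp [Alg.withBudget, expect]
  | prop k ih => cases B <;> simp [Alg.withBudget, expect, expect_const, ih]
  | unif k ih => cases B <;> simp [Alg.withBudget, expect, expect_const, ih]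
  | coin μ k ih => simp only [Alg.withBudget, expect, ih]

end Expect

/-! ### Failure probabilities -/

section Failure

variable {I α β : Type*} (P Q : PMF I)

open Classical in
/-- The probability that `A` aborts or violates the specification `S`, a property of the output and
of the number of samples. -/
noncomputable def failProb (A : Alg I α) (S : α → ℕ → Prop) : ℝ≥0∞ :=
  expect P Q A fun o c => o.elim 1 fun x => if S x c then 0 else 1

theorem failProb_mono (A : Alg I α) {S S' : α → ℕ → Prop} (h : ∀ x c, S x c → S' x c) :
    failProb P Q A S' ≤ failProb P Q A S := by
  refine expect_mono P Q A fun o c => ?_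
  cases o with
  | none => exact le_rfl
  | some x => by_cases hS : S x c <;> simp [hS, h x c, ite_le_one]

theorem failProb_le_one (A : Alg I α) (S : α → ℕ → Prop) : failProb P Q A S ≤ 1 := by
  refine (expect_mono P Q A fun o c => ?_).trans_eq (expect_const P Q A 1)
  cases o with
  | none => exact le_rfl
  | some x => by_cases hS : S x c <;> simp [hS]

theorem failProb_bind (A : Alg I α) (f : α → Alg I β) (S : β → ℕ → Prop) :
    failProb P Q (A.bind f) S = expect P Q A fun o c =>
      o.elim 1 fun x => failProb P Q (f x) fun y d => S y (c + d) := by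
  rw [failProb, expect_bind]
  rfl

theorem failProb_bind_ret (A : Alg I α) (f : α → β) (S : β → ℕ → Prop) :
    failProb P Q (A.bind fun x => .ret (f x)) S = failProb P Q A fun x c => S (f x) c := by
  rw [failProb_bind]
  rfl

theorem failProb_le_add_expect (A : Alg I α) {S T : α → ℕ → Prop} {g : α → ℕ → ℝ≥0∞}
    (h : ∀ x c, T x c → ¬S x c → 1 ≤ g x c) :
    failProb P Q A S ≤ failProb P Q A T + expect P Q A fun o c => o.elim 0 fun x => g x c := by
  simp only [failProb]
  rw [← expect_add]
  refine expect_mono P Q A fun o c => ?_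
  cases o with
  | none => exact le_self_add
  | some x => by_cases hS : S x c <;> by_cases hT : T x c <;> simp [hS, hT, h x c]

theorem failProb_and_le (A : Alg I α) (S T : α → ℕ → Prop) :
    failProb P Q A (fun x c => S x c ∧ T x c) ≤ failProb P Q A S + failProb P Q A T := by
  simp only [failProb]
  rw [← expect_add]
  refine expect_mono P Q A fun o c => ?_
  cases o with
  | none => exact le_self_add
  | some x => by_cases hS : S x c <;> by_cases hT : T x c <;> simp [hS, hT]

theorem failProb_bind_le (A : Alg I α) (f : α → Alg I β) (S : α → ℕ → Prop) (S' : β → ℕ → Prop)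
    {δ δ' : ℝ≥0∞} (h : failProb P Q A S ≤ δ)
    (h' : ∀ x c, S x c → failProb P Q (f x) (fun y d => S' y (c + d)) ≤ δ') :
    failProb P Q (A.bind f) S' ≤ δ + δ' := by
  refine le_trans ?_ (add_le_add_left h δ')
  rw [failProb_bind, ← expect_const P Q A δ', failProb, ← expect_add]
  refine expect_mono P Q A fun o c => ?_
  cases o with
  | none => exact le_self_add
  | some x =>
    by_cases hS : S x c
    · simpa [hS, expect_const] using h' x c hS
    · simpa [hS] using (failProb_le_one P Q (f x) _).trans le_self_add

theorem expect_success_add_failProb (A : Alg I α) (S : α → ℕ → Prop) [∀ x c, Decidable (S x c)] :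
    expect P Q A (fun o c => o.elim 0 fun x => if S x c then 1 else 0) + failProb P Q A S = 1 := by
  rw [failProb, ← expect_add]
  refine Eq.trans ?_ (expect_const P Q A 1)
  congr 1
  funext o c
  cases o with
  | none => simp
  | some x => by_cases h : S x c <;> simp [h]

end Failure

section Run

variable {U α : Type*}

theorem tsum_pure_mul (b : α) (g : α → ℝ≥0∞) : ∑' y, PMF.pure b y * g y = g b := by
  rw [tsum_eq_single b fun y hy => by simp [PMF.pure_apply, hy]]
  simp

theorem tsum_bind_mul {β : Type*} (p : PMF α) (f : α → PMF β) (g : β → ℝ≥0∞) :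
    ∑' y, p.bind f y * g y = ∑' b, p b * ∑' y, f b y * g y := by
  simp only [PMF.bind_apply, ← ENNReal.tsum_mul_right, ← ENNReal.tsum_mul_left, mul_assoc]
  rw [ENNReal.tsum_comm]

theorem tsum_map_mul {β : Type*} (p : PMF α) (f : α → β) (g : β → ℝ≥0∞) :
    ∑' y, p.map f y * g y = ∑' b, p b * g (f b) := by
  simp only [PMF.map, tsum_bind_mul, Function.comp, tsum_pure_mul]

/-- The law of the answer to a sample of law `R` on an instance with weights `w`. -/
noncomputable def answerLaw (w : U → ℝ≥0) (R : PMF U) : PMF (U × ℝ≥0) := R.map fun a => (a, w a)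

variable [Fintype U] [Nonempty U]

theorem tsum_run_mul (w : U → ℝ≥0) (hW : ∑ a, w a ≠ 0) (A : Alg (U × ℝ≥0) α)
    (g : Option α × ℕ → ℝ≥0∞) :
    ∑' y, run w hW A y * g y =
      expect (answerLaw w (propDist w hW)) (answerLaw w (PMF.uniformOfFintype U)) A
        fun o c => g (o, c) := by
  induction A generalizing g with
  | ret x => exact tsum_pure_mul _ _
  | abort => exact tsum_pure_mul _ _
  | prop k ih => simp only [run, expect, answerLaw, tsum_bind_mul, tsum_map_mul, ih]
  | unif k ih => simp only [run, expect, answerLaw, tsum_bind_mul, tsum_map_mul, ih]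
  | coin μ k ih => simp only [run, expect, tsum_bind_mul, ih]

theorem run_withBudget_cost_le (w : U → ℝ≥0) (hW : ∑ a, w a ≠ 0) (A : Alg (U × ℝ≥0) α) (B : ℕ) :
    ∀ y ∈ (run w hW (A.withBudget B)).support, y.2 ≤ B := by
  have sample_cost (R : PMF U) (k : U × ℝ≥0 → Alg (U × ℝ≥0) α) (B : ℕ)
      (ih : ∀ a, ∀ y ∈ (run w hW ((k a).withBudget B)).support, y.2 ≤ B) :
      ∀ y ∈ (R.bind fun a => (run w hW ((k (a, w a)).withBudget B)).map
        fun y => (y.1, y.2 + 1)).support, y.2 ≤ B + 1 := by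
    intro y hy
    simp only [PMF.mem_support_bind_iff, PMF.mem_support_map_iff] at hy
    obtain ⟨a, -, z, hz, rfl⟩ := hy
    exact Nat.succ_le_succ (ih _ z hz)
  induction A generalizing B with
  | ret x => simp [Alg.withBudget, run]
  | abort => simp [Alg.withBudget, run]
  | prop k ih =>
    cases B with
    | zero => simp [Alg.withBudget, run]
    | succ B => exact sample_cost _ k B fun a => ih a B
  | unif k ih =>
    cases B with
    | zero => simp [Alg.withBudget, run]
    | succ B => exact sample_cost _ k B fun a => ih a B
  | coin μ k ih =>
    intro y hy
    simp only [Alg.withBudget, run, PMF.mem_support_bind_iff] at hy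
    obtain ⟨c, -, hz⟩ := hy
    exact ih _ _ y hz

theorem run_withBudget_success_add_failProb (w : U → ℝ≥0) (hW : ∑ a, w a ≠ 0)
    (A : Alg (U × ℝ≥0) α) (B : ℕ) (G : α → Prop) :
    (run w hW (A.withBudget B)).toOuterMeasure {y | ∃ x, y.1 = some x ∧ G x} +
      failProb (answerLaw w (propDist w hW)) (answerLaw w (PMF.uniformOfFintype U)) A
        (fun x c => G x ∧ c ≤ B) = 1 := by
  classical
  have hsuccess : (run w hW (A.withBudget B)).toOuterMeasure {y | ∃ x, y.1 = some x ∧ G x} =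
      ∑' y, run w hW (A.withBudget B) y * y.1.elim 0 fun x => if G x then 1 else 0 := by
    rw [PMF.toOuterMeasure_apply]
    refine tsum_congr fun ⟨o, c⟩ => ?_
    cases o with
    | none => simp
    | some x => by_cases h : G x <;> simp [Set.indicator, h]
  rw [hsuccess, tsum_run_mul, expect_withBudget]
  convert expect_success_add_failProb (answerLaw w (propDist w hW)) _ A
    (fun x c => G x ∧ c ≤ B) using 3
  funext o c
  cases o with
  | none => simp
  | some x => by_cases h : G x <;> by_cases h' : c ≤ B <;> simp [h, h']

end Run

/-! ### Drawing all ranks in advance -/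

section Ranks

variable {U α : Type*}

/-- Every rank in the table is the rank of an item. -/
def Consistent [DecidableEq U] (T : List (U × ℕ)) : Prop :=
  ∀ r ∈ T.map Prod.snd, ∃ a, T.lookup a = some r

/-- The ranks below `n` that the table `T` does not use yet. -/
def freeRanks (n : ℕ) (T : List (U × ℕ)) : Finset ℕ :=
  Finset.range n \ (T.map Prod.snd).toFinset

/-- The assignments of ranks to all items that agree with the table `T`. -/
def extensions [DecidableEq U] [Fintype U] (n : ℕ) (T : List (U × ℕ)) : Finset (U ≃ Fin n) :=
  {σ | ∀ a r, T.lookup a = some r → (σ a : ℕ) = r}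

/-- The answer to a sample of `a`, once the items have weights `w` and ranks `ρ`. -/
def rankedItem (w : U → ℝ≥0) (ρ : U → ℕ) (a : U) : Item U := ⟨a, w a, ρ a⟩

/-- The law of the answer to a sample of law `R`, once the items have weights `w` and ranks `ρ`. -/
noncomputable def rankedLaw (w : U → ℝ≥0) (ρ : U → ℕ) (R : PMF U) : PMF (Item U) :=
  R.map (rankedItem w ρ)

variable [DecidableEq U] {T : List (U × ℕ)} {a : U} {n : ℕ}

theorem Consistent.cons (hT : Consistent T) (ha : T.lookup a = none) (r : ℕ) :
    Consistent ((a, r) :: T) := by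
  intro s hs
  simp only [List.map_cons, List.mem_cons] at hs
  rcases hs with rfl | hs
  · exact ⟨a, by simp⟩
  · obtain ⟨b, hb⟩ := hT s hs
    have hne : b ≠ a := by rintro rfl; simp [ha] at hb
    exact ⟨b, by simpa [List.lookup_cons, beq_eq_false_iff_ne.2 hne] using hb⟩

theorem mem_map_snd_of_lookup {r : ℕ} (h : T.lookup a = some r) : r ∈ T.map Prod.snd := by
  obtain ⟨l₁, l₂, rfl, -⟩ := List.lookup_eq_some_iff.1 h
  simp

variable [Fintype U]

theorem mem_extensions {σ : U ≃ Fin n} :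
    σ ∈ extensions n T ↔ ∀ a r, T.lookup a = some r → (σ a : ℕ) = r := by
  simp [extensions]

theorem mem_extensions_cons (ha : T.lookup a = none) {r : ℕ} {σ : U ≃ Fin n} :
    σ ∈ extensions n ((a, r) :: T) ↔ σ ∈ extensions n T ∧ (σ a : ℕ) = r := by
  simp only [mem_extensions, List.lookup_cons]
  constructor
  · refine fun h => ⟨fun b s hb => h b s ?_, h a r (by simp)⟩
    have hne : b ≠ a := by rintro rfl; simp [ha] at hb
    simpa [beq_eq_false_iff_ne.2 hne] using hb
  · rintro ⟨h, h'⟩ b s hb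
    rcases eq_or_ne b a with rfl | hne
    · simp only [beq_self_eq_true, Option.some.injEq] at hb
      exact h'.trans hb
    · exact h b s (by simpa [beq_eq_false_iff_ne.2 hne] using hb)

theorem rank_mem_freeRanks (hT : Consistent T) (ha : T.lookup a = none) {σ : U ≃ Fin n}
    (hσ : σ ∈ extensions n T) : (σ a : ℕ) ∈ freeRanks n T := by
  simp only [freeRanks, Finset.mem_sdiff, Finset.mem_range, (σ a).isLt, true_and, List.mem_toFinset]
  intro hused
  obtain ⟨b, hb⟩ := hT _ hused
  obtain rfl : b = a := σ.injective (Fin.ext (mem_extensions.1 hσ b _ hb))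
  simp [ha] at hb

theorem card_extensions_cons_le (ha : T.lookup a = none) {r s : ℕ}
    (hr : r ∈ freeRanks n T) (hs : s ∈ freeRanks n T) :
    (extensions n ((a, r) :: T)).card ≤ (extensions n ((a, s) :: T)).card := by
  simp only [freeRanks, Finset.mem_sdiff, Finset.mem_range, List.mem_toFinset] at hr hs
  refine Finset.card_le_card_of_injOn
    (fun σ => σ.trans (Equiv.swap (⟨r, hr.1⟩ : Fin n) ⟨s, hs.1⟩)) ?_ ?_
  · intro σ hσ
    simp only [Finset.mem_coe, mem_extensions_cons ha, mem_extensions] at hσ ⊢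
    refine ⟨fun b t hb => ?_, ?_⟩
    · have hbt : (σ b : ℕ) = t := hσ.1 b t hb
      have ht := mem_map_snd_of_lookup hb
      rw [Equiv.trans_apply, Equiv.swap_apply_of_ne_of_ne, hbt]
      · exact fun h => hr.2 (by rwa [← hbt, h] at ht)
      · exact fun h => hs.2 (by rwa [← hbt, h] at ht)
    · rw [Equiv.trans_apply, show σ a = ⟨r, hr.1⟩ from Fin.ext hσ.2, Equiv.swap_apply_left]
  · exact fun σ _ τ _ h => (Equiv.refl U).equivCongr (Equiv.swap _ _) |>.injective h

theorem sum_extensions_eq_sum_freeRanks {M : Type*} [AddCommMonoid M] (hT : Consistent T)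
    (ha : T.lookup a = none) (F : (U ≃ Fin n) → M) :
    ∑ σ ∈ extensions n T, F σ = ∑ r ∈ freeRanks n T, ∑ σ ∈ extensions n ((a, r) :: T), F σ := by
  rw [← Finset.sum_fiberwise_of_maps_to (g := fun σ => (σ a : ℕ))
    fun σ hσ => rank_mem_freeRanks hT ha hσ]
  refine Finset.sum_congr rfl fun r _ => Finset.sum_congr ?_ fun _ _ => rfl
  ext σ
  rw [Finset.mem_filter, mem_extensions_cons ha]

theorem card_extensions_eq_card_freeRanks_mul (hT : Consistent T) (ha : T.lookup a = none) {r : ℕ}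
    (hr : r ∈ freeRanks n T) :
    (extensions n T).card = (freeRanks n T).card * (extensions n ((a, r) :: T)).card := by
  rw [Finset.card_eq_sum_ones, sum_extensions_eq_sum_freeRanks hT ha]
  simp only [← Finset.card_eq_sum_ones]
  exact Finset.sum_const_nat fun s hs =>
    (card_extensions_cons_le ha hs hr).antisymm (card_extensions_cons_le ha hr hs)

/-- Deferred decisions: a rank drawn when its item is first seen might as well have been drawn in
advance, together with all the others. -/
theorem card_mul_tsum_freshRank (hT : Consistent T) (ha : T.lookup a = none) (h : ℕ → ℝ≥0∞) :
    (extensions n T).card * ∑' r, freshRank n T r * h r =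
      ∑ r ∈ freeRanks n T, (extensions n ((a, r) :: T)).card * h r := by
  rcases (freeRanks n T).eq_empty_or_nonempty with hempty | hfree
  · rw [Finset.card_eq_sum_ones, sum_extensions_eq_sum_freeRanks hT ha, hempty]
    simp
  · rw [show freshRank n T = PMF.uniformOfFinset _ hfree from dif_pos hfree,
      tsum_eq_sum (s := freeRanks n T) fun r hr => by
        rw [PMF.uniformOfFinset_apply_of_notMem hfree hr, zero_mul], Finset.mul_sum]
    refine Finset.sum_congr rfl fun r hr => ?_
    have hcard : ((freeRanks n T).card : ℝ≥0∞) ≠ 0 := by simpa using hfree.ne_empty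
    rw [PMF.uniformOfFinset_apply_of_mem hfree hr,
      card_extensions_eq_card_freeRanks_mul hT ha hr, Nat.cast_mul, ← mul_assoc,
      mul_right_comm ((freeRanks n T).card : ℝ≥0∞), ENNReal.mul_inv_cancel hcard (by simp), one_mul]

theorem card_mul_expect_withRank {I : Type*} (P Q : PMF I) (hT : Consistent T) (a : U)
    (k : ℕ → List (U × ℕ) → Alg I α) (g : Option α → ℕ → ℝ≥0∞) (F : ℕ → (U ≃ Fin n) → ℝ≥0∞)
    (hk : ∀ r T, Consistent T →
      (extensions n T).card * expect P Q (k r T) g = ∑ σ ∈ extensions n T, F r σ) :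
    (extensions n T).card * expect P Q (withRank n T a k) g = ∑ σ ∈ extensions n T, F (σ a) σ := by
  unfold withRank
  cases ha : T.lookup a with
  | some r =>
    simp only [hk r T hT]
    exact Finset.sum_congr rfl fun σ hσ => by rw [mem_extensions.1 hσ a r ha]
  | none =>
    simp only [expect]
    rw [card_mul_tsum_freshRank hT ha, sum_extensions_eq_sum_freeRanks hT ha]
    refine Finset.sum_congr rfl fun r _ => ?_
    rw [hk r _ (hT.cons ha r)]
    exact Finset.sum_congr rfl fun σ hσ => by rw [((mem_extensions_cons ha).1 hσ).2]

theorem card_mul_expect_attachRanks (P Q : PMF U) (w : U → ℝ≥0) (A : Alg (Item U) α)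
    (hT : Consistent T) (g : Option α → ℕ → ℝ≥0∞) :
    (extensions n T).card * expect (answerLaw w P) (answerLaw w Q) (attachRanks n A T) g =
      ∑ σ ∈ extensions n T, expect (rankedLaw w (σ ·) P) (rankedLaw w (σ ·) Q) A g := by
  induction A generalizing T g with
  | ret x => simp [attachRanks, expect]
  | abort => simp [attachRanks, expect]
  | prop k ih =>
    simp only [attachRanks, expect, answerLaw, rankedLaw, tsum_map_mul] at ih ⊢
    rw [← ENNReal.tsum_mul_left, ← Summable.tsum_finsetSum fun _ _ => ENNReal.summable]
    refine tsum_congr fun a => ?_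
    rw [mul_left_comm, card_mul_expect_withRank _ _ hT a _ _ _ fun r T hT => ih ⟨a, w a, r⟩ hT _,
      Finset.mul_sum]
    rfl
  | unif k ih =>
    simp only [attachRanks, expect, answerLaw, rankedLaw, tsum_map_mul] at ih ⊢
    rw [← ENNReal.tsum_mul_left, ← Summable.tsum_finsetSum fun _ _ => ENNReal.summable]
    refine tsum_congr fun a => ?_
    rw [mul_left_comm, card_mul_expect_withRank _ _ hT a _ _ _ fun r T hT => ih ⟨a, w a, r⟩ hT _,
      Finset.mul_sum]
    rfl
  | coin μ k ih =>
    simp only [attachRanks, expect]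
    rw [← ENNReal.tsum_mul_left, ← Summable.tsum_finsetSum fun _ _ => ENNReal.summable]
    exact tsum_congr fun c => by rw [mul_left_comm, ih c hT, Finset.mul_sum]

theorem failProb_attachRanks_le (P Q : PMF U) (w : U → ℝ≥0) (A : Alg (Item U) α)
    (S : α → ℕ → Prop) {δ : ℝ≥0∞}
    (h : ∀ ρ : U → ℕ, ρ.Injective → failProb (rankedLaw w ρ P) (rankedLaw w ρ Q) A S ≤ δ) :
    failProb (answerLaw w P) (answerLaw w Q) (attachRanks (Fintype.card U) A []) S ≤ δ := by
  set E := extensions (Fintype.card U) ([] : List (U × ℕ))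
  have hE : (E.card : ℝ≥0∞) ≠ 0 := by
    have : Fintype.equivFin U ∈ E := by simp [E, mem_extensions]
    simpa using Finset.ne_empty_of_mem this
  rw [← ENNReal.mul_le_mul_iff_right hE (by simp), failProb,
    card_mul_expect_attachRanks P Q w A (by simp [Consistent]), ← nsmul_eq_mul]
  exact Finset.sum_le_card_nsmul _ _ _ fun σ _ => h _ (Fin.val_injective.comp σ.injective)

end Ranks

/-! ### Order statistics of lists -/

section OrderStatistics

variable {α : Type*} [LinearOrder α] [OrderBot α] {s : Set α} [DecidablePred (· ∈ s)]

theorem getD_mem_iff_lt_countP (hs : IsUpperSet s) {l : List α} (hl : l.Pairwise (· ≥ ·)) {i : ℕ}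
    (hi : i < l.length) : l.getD i ⊥ ∈ s ↔ i < l.countP (· ∈ s) := by
  induction l generalizing i with
  | nil => simp at hi
  | cons a t ih =>
    obtain ⟨hat, ht⟩ := List.pairwise_cons.1 hl
    by_cases ha : a ∈ s
    · cases i with
      | zero => simp [ha]
      | succ i =>
        simp only [List.getD_cons_succ, List.countP_cons, ha, decide_true, if_true]
        rw [ih ht (by simpa using hi), Nat.succ_lt_succ_iff]
    · have h0 : t.countP (· ∈ s) = 0 :=
        List.countP_eq_zero.2 fun x hx => by simpa using fun h => ha (hs (hat x hx) h)
      cases i with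
      | zero => simp [ha, h0]
      | succ i =>
        rw [List.getD_cons_succ, ih ht (by simpa using hi), h0]
        simp [ha, h0]

theorem kthLargest_mem_iff (hs : IsUpperSet s) {l : List α} {k : ℕ} (hk : 0 < k)
    (hkl : k ≤ l.length) : kthLargest k l ∈ s ↔ k ≤ l.countP (· ∈ s) := by
  unfold kthLargest
  rw [getD_mem_iff_lt_countP hs (List.pairwise_insertionSort _ l)
    (by rw [List.length_insertionSort]; omega), (List.perm_insertionSort _ l).countP_eq]
  omega

open Classical in
theorem median_mem_Icc {l : List α} {k : ℕ} (hl : l.length = 2 * k + 1) {lo hi : α}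
    (h : l.countP (· ∉ Set.Icc lo hi) ≤ k) : median l ∈ Set.Icc lo hi := by
  have hk : (l.length + 1) / 2 = k + 1 := by omega
  have hcount := List.length_eq_countP_add_countP (· ∈ Set.Icc lo hi) (l := l)
  simp only [decide_eq_true_eq] at hcount
  unfold median
  rw [hk]
  constructor
  · rw [← Set.mem_Ici, kthLargest_mem_iff (isUpperSet_Ici lo) (by omega) (by omega)]
    have : l.countP (· ∈ Set.Icc lo hi) ≤ l.countP (· ∈ Set.Ici lo) :=
      List.countP_mono_left fun x _ hx => by simp only [decide_eq_true_eq] at hx ⊢; exact hx.1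
    omega
  · by_contra hlt
    rw [not_le, ← Set.mem_Ioi, kthLargest_mem_iff (isUpperSet_Ioi hi) (by omega) (by omega)] at hlt
    have : l.countP (· ∈ Set.Ioi hi) ≤ l.countP (· ∉ Set.Icc lo hi) :=
      List.countP_mono_left fun x _ hx => by
        simp only [decide_eq_true_eq] at hx ⊢; exact fun h => hx.not_ge h.2
    omega

end OrderStatistics

/-! ### Independent repetitions and medians -/

section Replicate

variable {I α : Type*} (P Q : PMF I) (A : Alg I α)

theorem failProb_replicate_all {G : α → Prop} {B : ℕ} {δ : ℝ≥0∞}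
    (h : failProb P Q A (fun x c => G x ∧ c ≤ B) ≤ δ) (m : ℕ) :
    failProb P Q (A.replicate m) (fun l c => l.length = m ∧ (∀ x ∈ l, G x) ∧ c ≤ m * B) ≤
      m * δ := by
  induction m with
  | zero => simp [Alg.replicate, failProb, expect]
  | succ m ih =>
    rw [Nat.cast_succ, add_one_mul (m : ℝ≥0∞), add_comm (m * δ)]
    refine failProb_bind_le P Q A _ _ _ h fun x c hx => ?_
    rw [failProb_bind_ret]
    refine (failProb_mono P Q _ ?_).trans ih
    rintro l d ⟨hl, hG, hd⟩
    refine ⟨by simp [hl], by simpa using ⟨hx.1, hG⟩, ?_⟩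
    rw [Nat.succ_mul, add_comm]
    exact add_le_add hd hx.2

theorem failProb_replicate_propSample_eq_zero (m : ℕ) :
    failProb P Q (Alg.propSample.replicate m) (fun _ c => c ≤ m) = 0 := by
  have h := failProb_replicate_all P Q Alg.propSample (G := fun _ => True) (B := 1) (δ := 0)
    (by simp [failProb, Alg.propSample, expect]) m
  rw [mul_zero] at h
  exact le_antisymm ((failProb_mono P Q _ fun l c hl => by simpa using hl.2.2).trans h) zero_le

theorem expect_replicate_pow_countP (G : α → Prop) [DecidablePred G] (r : ℝ≥0∞) (m : ℕ) :
    expect P Q (A.replicate m) (fun o _ => o.elim 0 fun l => r ^ l.countP (G ·)) =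
      (expect P Q A fun o _ => o.elim 0 fun x => if G x then r else 1) ^ m := by
  induction m with
  | zero => simp [Alg.replicate, expect]
  | succ m ih =>
    rw [pow_succ, ← ih, ← expect_mul_left]
    simp only [Alg.replicate]
    rw [expect_bind]
    congr 1
    funext o _
    cases o with
    | none => simp
    | some x =>
      simp only [Option.elim]
      rw [expect_bind, mul_comm, ← expect_mul_left]
      congr 1
      funext o _
      cases o <;> by_cases hx : G x <;> simp [expect, hx, pow_succ']

variable {P Q A} {B : ℕ} {δ : ℝ≥0∞}

theorem failProb_replicate_countP_lt (h : failProb P Q A (fun _ c => c ≤ B) ≤ δ) (G : α → Prop)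
    [DecidablePred G] {r : ℝ≥0∞} (hr : 1 ≤ r) (hr' : r ≠ ⊤) (m k : ℕ) :
    failProb P Q (A.replicate m) (fun l c => l.length = m ∧ c ≤ m * B ∧ l.countP (G ·) < k) ≤
      m * δ + r⁻¹ ^ k * (expect P Q A fun o _ => o.elim 0 fun x => if G x then r else 1) ^ m := by
  have hr0 : r ≠ 0 := (zero_lt_one.trans_le hr).ne'
  rw [← expect_replicate_pow_countP, ← expect_mul_left]
  refine (failProb_le_add_expect P Q _ (g := fun l _ => r⁻¹ ^ k * r ^ l.countP (G ·)) ?_).trans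
    (add_le_add (failProb_replicate_all P Q A (G := fun _ => True) (by simpa using h) m)
      (expect_mono P Q _ fun o _ => by cases o <;> simp))
  rintro l c ⟨hl, -, hc⟩ hcount
  have hk : k ≤ l.countP (G ·) := by simpa [hl, hc] using hcount
  calc (1 : ℝ≥0∞) = r⁻¹ ^ k * r ^ k := by
        rw [← mul_pow, ENNReal.inv_mul_cancel hr0 hr', one_pow]
    _ ≤ _ := by gcongr

theorem failProb_replicate_le_countP (h : failProb P Q A (fun _ c => c ≤ B) ≤ δ) (G : α → Prop)
    [DecidablePred G] {r : ℝ≥0∞} (hr : r ≤ 1) (hr0 : r ≠ 0) (m k : ℕ) :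
    failProb P Q (A.replicate m) (fun l c => l.length = m ∧ c ≤ m * B ∧ k ≤ l.countP (G ·)) ≤
      m * δ + r⁻¹ ^ k * (expect P Q A fun o _ => o.elim 0 fun x => if G x then r else 1) ^ m := by
  have hr' : r ≠ ⊤ := (hr.trans_lt ENNReal.one_lt_top).ne
  rw [← expect_replicate_pow_countP, ← expect_mul_left]
  refine (failProb_le_add_expect P Q _ (g := fun l _ => r⁻¹ ^ k * r ^ l.countP (G ·)) ?_).trans
    (add_le_add (failProb_replicate_all P Q A (G := fun _ => True) (by simpa using h) m)
      (expect_mono P Q _ fun o _ => by cases o <;> simp))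
  rintro l c ⟨hl, -, hc⟩ hcount
  have hk : l.countP (G ·) ≤ k := le_of_lt (by simpa [hl, hc] using hcount)
  calc (1 : ℝ≥0∞) = r⁻¹ ^ k * r ^ k := by
        rw [← mul_pow, ENNReal.inv_mul_cancel hr0 hr', one_pow]
    _ ≤ _ := by gcongr r⁻¹ ^ k * ?_; exact pow_le_pow_of_le_one zero_le hr hk

variable [LinearOrder α] [OrderBot α]

theorem failProb_amplify_ge {lo : α} (h : failProb P Q A (fun x c => lo ≤ x ∧ c ≤ B) ≤ δ) (q : ℝ) :
    failProb P Q (amplify q A) (fun x c => lo ≤ x ∧ c ≤ (2 * ⌈4 / (1 - q)⌉₊ + 1) * B) ≤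
      (2 * ⌈4 / (1 - q)⌉₊ + 1 : ℕ) * δ := by
  unfold amplify
  rw [failProb_bind_ret]
  refine (failProb_mono P Q _ ?_).trans (failProb_replicate_all P Q A h _)
  rintro l c ⟨hl, hG, hc⟩
  refine ⟨?_, hc⟩
  unfold median
  rw [← Set.mem_Ici, kthLargest_mem_iff (isUpperSet_Ici lo) (by omega) (by omega),
    List.countP_eq_length.2 (by simpa using hG)]
  omega

theorem failProb_amplify_mem_Icc_le_add_tail {lo hi : α}
    (hgood : failProb P Q A (fun x _ => x ∈ Set.Icc lo hi) ≤ 1 / 3)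
    (hcost : failProb P Q A (fun _ c => c ≤ B) ≤ δ) (q : ℝ) :
    failProb P Q (amplify q A)
      (fun x c => x ∈ Set.Icc lo hi ∧ c ≤ (2 * ⌈4 / (1 - q)⌉₊ + 1) * B) ≤
      (2 * ⌈4 / (1 - q)⌉₊ + 1 : ℕ) * δ +
        2⁻¹ ^ (⌈4 / (1 - q)⌉₊ + 1) * (4 / 3) ^ (2 * ⌈4 / (1 - q)⌉₊ + 1) := by
  classical
  have hweight : (expect P Q A fun o _ => o.elim 0 fun x => if x ∉ Set.Icc lo hi then 2 else 1) ≤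
      4 / 3 := by
    calc _ ≤ expect P Q A fun o _ => 1 + o.elim 1 fun x => if x ∈ Set.Icc lo hi then 0 else 1 := by
          refine expect_mono P Q A fun o _ => ?_
          cases o with
          | none => simp
          | some x => by_cases h : x ∈ Set.Icc lo hi <;> simp [-Set.mem_Icc, h, one_add_one_eq_two]
      _ = 1 + failProb P Q A (fun x _ => x ∈ Set.Icc lo hi) := by
          rw [expect_add, expect_const, failProb]
          congr!
      _ ≤ 1 + 1 / 3 := by gcongr
      _ = 4 / 3 := by
          rw [← ENNReal.toReal_eq_toReal_iff' (by finiteness) (by finiteness)]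
          norm_num [ENNReal.toReal_add]
  unfold amplify
  rw [failProb_bind_ret]
  refine ((failProb_mono P Q _ ?_).trans
    (failProb_replicate_countP_lt hcost (· ∉ Set.Icc lo hi) one_le_two (by simp) _ _)).trans
    (by gcongr)
  rintro l c ⟨hl, hc, hcount⟩
  exact ⟨median_mem_Icc hl (Nat.lt_succ_iff.1 hcount), hc⟩

theorem median_tail_le {k : ℕ} (hk : 40 ≤ k) :
    (2⁻¹ ^ (k + 1) * (4 / 3) ^ (2 * k + 1) : ℝ≥0∞) ≤ ENNReal.ofReal (1 / 100) := by
  have h43 : (4 / 3 : ℝ≥0∞) = ENNReal.ofReal (4 / 3) := by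
    rw [ENNReal.ofReal_div_of_pos (by norm_num)]; norm_num
  have h2 : (2⁻¹ : ℝ≥0∞) = ENNReal.ofReal 2⁻¹ := by
    rw [ENNReal.ofReal_inv_of_pos (by norm_num)]; norm_num
  rw [h43, h2, ← ENNReal.ofReal_pow (by norm_num), ← ENNReal.ofReal_pow (by norm_num),
    ← ENNReal.ofReal_mul (by positivity)]
  apply ENNReal.ofReal_le_ofReal
  calc (2⁻¹ ^ (k + 1) * (4 / 3) ^ (2 * k + 1) : ℝ) = 2 / 3 * (8 / 9) ^ k := by
        rw [pow_succ, pow_succ, pow_mul, mul_mul_mul_comm, ← mul_pow]; norm_num [mul_comm]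
    _ ≤ 2 / 3 * (8 / 9) ^ 40 := by
        gcongr _ * ?_; exact pow_le_pow_of_le_one (by norm_num) (by norm_num) hk
    _ ≤ 1 / 100 := by norm_num

theorem failProb_amplify_mem_Icc_le {q : ℝ} {k : ℕ} (hq : ⌈4 / (1 - q)⌉₊ = k) (hk : 40 ≤ k)
    {lo hi : α} {δ : ℝ} (hδ : 0 ≤ δ)
    (hgood : failProb P Q A (fun x _ => x ∈ Set.Icc lo hi) ≤ ENNReal.ofReal (1 / 3))
    (hcost : failProb P Q A (fun _ c => c ≤ B) ≤ ENNReal.ofReal δ) :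
    failProb P Q (amplify q A) (fun x c => x ∈ Set.Icc lo hi ∧ c ≤ (2 * k + 1) * B) ≤
      ENNReal.ofReal ((2 * k + 1) * δ + 1 / 100) := by
  have h3 : ENNReal.ofReal (1 / 3) = 1 / 3 := by
    rw [ENNReal.ofReal_div_of_pos (by norm_num)]; norm_num
  have hmedian := failProb_amplify_mem_Icc_le_add_tail (hgood.trans_eq h3) hcost q
  rw [hq] at hmedian
  refine hmedian.trans ?_
  rw [ENNReal.ofReal_add (by positivity) (by norm_num), ENNReal.ofReal_mul (by positivity)]
  gcongr
  · rw [← ENNReal.ofReal_natCast]; push_cast; rfl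
  · exact median_tail_le hk

end Replicate

/-! ### Inverse sampling -/

section Bernoulli

variable {I α : Type*}

/-- The probability of the set `s` under `R`, as a real number. -/
noncomputable def prob (R : PMF α) (s : Set α) : ℝ := (R.toOuterMeasure s).toReal

theorem prob_nonneg (R : PMF α) (s : Set α) : 0 ≤ prob R s := ENNReal.toReal_nonneg

theorem toOuterMeasure_le_one (R : PMF α) (s : Set α) : R.toOuterMeasure s ≤ 1 := by
  rw [PMF.toOuterMeasure_apply, ← R.tsum_coe]
  exact ENNReal.tsum_le_tsum fun a => Set.indicator_le_self s R a

theorem prob_le_one (R : PMF α) (s : Set α) : prob R s ≤ 1 :=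
  ENNReal.toReal_le_of_le_ofReal zero_le_one (by simpa using toOuterMeasure_le_one R s)

theorem ofReal_prob (R : PMF α) (s : Set α) : ENNReal.ofReal (prob R s) = R.toOuterMeasure s :=
  ENNReal.ofReal_toReal ((toOuterMeasure_le_one R s).trans_lt ENNReal.one_lt_top).ne

theorem tsum_mul_ite_eq_prob (R : PMF α) (G : α → Prop) [DecidablePred G] (b b' : ℝ≥0∞) :
    ∑' a, R a * (if G a then b else b') =
      ENNReal.ofReal (prob R {a | G a}) * b + ENNReal.ofReal (1 - prob R {a | G a}) * b' := by
  have hcompl : ENNReal.ofReal (1 - prob R {a | G a}) = ∑' a, if G a then 0 else R a := by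
    rw [ENNReal.ofReal_sub _ (prob_nonneg R _), ofReal_prob, ENNReal.ofReal_one, ← R.tsum_coe,
      PMF.toOuterMeasure_apply]
    refine ENNReal.sub_eq_of_eq_add_rev ?_ ?_
    · rw [← PMF.toOuterMeasure_apply]
      exact ((toOuterMeasure_le_one R _).trans_lt ENNReal.one_lt_top).ne
    · rw [← ENNReal.tsum_add]
      exact tsum_congr fun a => by by_cases h : G a <;> simp [h]
  rw [hcompl, ofReal_prob, PMF.toOuterMeasure_apply, ← ENNReal.tsum_mul_right,
    ← ENNReal.tsum_mul_right, ← ENNReal.tsum_add]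
  exact tsum_congr fun a => by by_cases h : G a <;> simp [h]

/-- `X` is an experiment that takes one sample and succeeds with probability `p`. -/
def IsExperiment (P Q : PMF I) (X : Alg I Bool) (p : ℝ) : Prop :=
  ∀ g : Option Bool → ℕ → ℝ≥0∞, expect P Q X g =
    ENNReal.ofReal p * g (some true) 1 + ENNReal.ofReal (1 - p) * g (some false) 1

theorem isExperiment_propSample (P Q : PMF I) (G : I → Prop) [DecidablePred G] :
    IsExperiment P Q (Alg.propSample.bind fun a => .ret (decide (G a))) (prob P {a | G a}) := by
  intro g
  rw [← tsum_mul_ite_eq_prob]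
  exact tsum_congr fun a => by by_cases h : G a <;> simp [Alg.bind, expect, h]

theorem isExperiment_unifSample (P Q : PMF I) (G : I → Prop) [DecidablePred G] :
    IsExperiment P Q (Alg.unifSample.bind fun a => .ret (decide (G a))) (prob Q {a | G a}) := by
  intro g
  rw [← tsum_mul_ite_eq_prob]
  exact tsum_congr fun a => by by_cases h : G a <;> simp [Alg.bind, expect, h]

/-- The second moment about `μ` of the number of independent trials, each successful with
probability `p`, up to the `r`-th success: it has mean `r / p` and variance `r (1 - p) / p ^ 2`. -/
noncomputable def trialsMoment (p : ℝ) (r : ℕ) (μ : ℝ) : ℝ :=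
  (r / p - μ) ^ 2 + r * (1 - p) / p ^ 2

variable {p : ℝ}

theorem trialsMoment_succ (hp : p ≠ 0) (r : ℕ) (μ : ℝ) :
    trialsMoment p (r + 1) μ =
      p * trialsMoment p r (μ - 1) + (1 - p) * trialsMoment p (r + 1) (μ - 1) := by
  simp only [trialsMoment]
  push_cast
  field_simp
  ring

theorem sq_le_trialsMoment (hp1 : p ≤ 1) (r : ℕ) (μ : ℝ) :
    (r / p - μ) ^ 2 ≤ trialsMoment p r μ :=
  le_add_of_nonneg_right
    (div_nonneg (mul_nonneg r.cast_nonneg (sub_nonneg.2 hp1)) (sq_nonneg p))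

theorem one_le_ofReal_trialsMoment_div (hp1 : p ≤ 1) {d : ℝ} (hd : 0 < d) {r : ℕ} {μ : ℝ}
    (h : d ≤ |r / p - μ|) : 1 ≤ ENNReal.ofReal (trialsMoment p r μ / d ^ 2) := by
  rw [ENNReal.one_le_ofReal, one_le_div (by positivity)]
  refine le_trans ?_ (sq_le_trialsMoment hp1 r μ)
  rw [← sq_abs (r / p - μ)]
  gcongr

variable {P Q : PMF I} {X : Alg I Bool}

theorem failProb_trials_zero_le (hp1 : p ≤ 1) {d : ℝ} (hd : 0 < d) (fuel : ℕ) (μ : ℝ) :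
    failProb P Q (trials X fuel 0) (fun N c => c = N ∧ 0 ≤ N ∧ |(N : ℝ) - μ| ≤ d) ≤
      ENNReal.ofReal (trialsMoment p 0 μ / d ^ 2) := by
  rcases le_total d |(0 : ℕ) / p - μ| with h | h
  · exact (failProb_le_one P Q _ _).trans (one_le_ofReal_trialsMoment_div hp1 hd h)
  · rw [Nat.cast_zero, zero_div] at h
    simp [trials, failProb, expect, -abs_neg, -zero_sub, h]

/-- Chebyshev's inequality for the number of trials. The bound on `fuel` ensures that a run which
is cut short is one whose number of trials deviates by `d`. -/
theorem failProb_trials_le (hX : IsExperiment P Q X p) (hp : 0 < p) (hp1 : p ≤ 1) {d : ℝ}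
    (hd : 0 < d) (fuel r : ℕ) (μ : ℝ) (hfuel : μ + d ≤ fuel) :
    failProb P Q (trials X fuel r) (fun N c => c = N ∧ r ≤ N ∧ |(N : ℝ) - μ| ≤ d) ≤
      ENNReal.ofReal (trialsMoment p r μ / d ^ 2) := by
  induction fuel generalizing r μ with
  | zero =>
    rcases le_total d |r / p - μ| with h | h
    · exact (failProb_le_one P Q _ _).trans (one_le_ofReal_trialsMoment_div hp1 hd h)
    · obtain rfl : r = 0 := by
        have hr : (r : ℝ) / p ≤ 0 := by
          rw [Nat.cast_zero] at hfuel
          linarith [(abs_le.1 h).2]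
        by_contra hr0
        exact hr.not_gt (div_pos (Nat.cast_pos.2 (Nat.pos_of_ne_zero hr0)) hp)
      exact failProb_trials_zero_le hp1 hd 0 μ
  | succ fuel ih =>
    cases r with
    | zero => exact failProb_trials_zero_le hp1 hd _ μ
    | succ r =>
      have rest (s : ℕ) (hs : r ≤ s) : failProb P Q (trials X fuel s)
          (fun N c => 1 + c = N + 1 ∧ r + 1 ≤ N + 1 ∧ |((N + 1 : ℕ) : ℝ) - μ| ≤ d) ≤
            ENNReal.ofReal (trialsMoment p s (μ - 1) / d ^ 2) := by
        refine (failProb_mono P Q _ ?_).trans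
          (ih s (μ - 1) (by push_cast at hfuel; linarith))
        rintro N c ⟨hc, hN, hdev⟩
        refine ⟨by omega, by omega, ?_⟩
        rwa [show ((N + 1 : ℕ) : ℝ) - μ = N - (μ - 1) by push_cast; ring]
      have hm (s : ℕ) : 0 ≤ trialsMoment p s (μ - 1) / d ^ 2 :=
        div_nonneg ((sq_nonneg _).trans (sq_le_trialsMoment hp1 s _)) (sq_nonneg d)
      simp only [trials]
      rw [failProb_bind, hX]
      simp only [Option.elim, if_true, Bool.false_eq_true, if_false, failProb_bind_ret]
      refine (add_le_add (mul_le_mul_right (rest r le_rfl) _)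
        (mul_le_mul_right (rest (r + 1) r.le_succ) _)).trans_eq ?_
      rw [← ENNReal.ofReal_mul hp.le, ← ENNReal.ofReal_mul (sub_nonneg.2 hp1),
        ← ENNReal.ofReal_add (mul_nonneg hp.le (hm _)) (mul_nonneg (sub_nonneg.2 hp1) (hm _)),
        trialsMoment_succ hp.ne' r μ, add_div, mul_div_assoc, mul_div_assoc]

theorem failProb_trials_relative_le (hX : IsExperiment P Q X p) (hp : 0 < p) (hp1 : p ≤ 1)
    {fuel r : ℕ} (hr : 0 < r) {t : ℝ} (ht : 0 < t) (hfuel : r / p * (1 + t) ≤ fuel) :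
    failProb P Q (trials X fuel r)
        (fun N c => c = N ∧ 0 < N ∧ r / p * (1 - t) ≤ N ∧ N ≤ r / p * (1 + t)) ≤
      ENNReal.ofReal (1 / (r * t ^ 2)) := by
  have : (0 : ℝ) < r := Nat.cast_pos.2 hr
  have hd : 0 < r / p * t := by positivity
  refine (failProb_mono P Q _ ?_).trans ((failProb_trials_le hX hp hp1 hd fuel r (r / p)
    (by linarith)).trans (ENNReal.ofReal_le_ofReal ?_))
  · rintro N c ⟨hc, hN, hdev⟩
    rw [abs_le] at hdev
    exact ⟨hc, hr.trans_le hN, by linarith, by linarith⟩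
  · calc trialsMoment p r (r / p) / (r / p * t) ^ 2 = (1 - p) / (r * t ^ 2) := by
          simp only [trialsMoment]; field_simp; ring
      _ ≤ 1 / (r * t ^ 2) := by gcongr; linarith

variable {ε : ℝ} {fuel : ℕ}

theorem le_natCeil_twelve_div_sq (hε : 0 < ε) (hε1 : ε < 1) :
    12 / ε ^ 2 ≤ (⌈12 / ε ^ 2⌉₊ : ℝ) ∧ (⌈12 / ε ^ 2⌉₊ : ℝ) ≤ 13 / ε ^ 2 := by
  refine ⟨Nat.le_ceil _, (Nat.ceil_lt_add_one (by positivity)).le.trans ?_⟩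
  have : 1 ≤ 1 / ε ^ 2 := by
    rw [one_le_div (by positivity)]
    exact pow_le_one₀ hε.le hε1.le
  calc 12 / ε ^ 2 + 1 ≤ 12 / ε ^ 2 + 1 / ε ^ 2 := by gcongr
    _ = 13 / ε ^ 2 := by ring

theorem failProb_bernoulliEstimator_mem_Icc_le (hX : IsExperiment P Q X p) (hp : 0 < p)
    (hp1 : p ≤ 1) (hε : 0 < ε) (hε1 : ε < 1) (hfuel : 20 / (ε ^ 2 * p) ≤ fuel) :
    failProb P Q (bernoulliEstimator fuel X ε) (fun x _ => x ∈ Set.Icc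
      (p / (1 + ε / 2)).toNNReal (p / (1 - ε / 2)).toNNReal) ≤ ENNReal.ofReal (1 / 3) := by
  obtain ⟨hr1, hr2⟩ := le_natCeil_twelve_div_sq hε hε1
  unfold bernoulliEstimator
  rw [failProb_bind_ret]
  set r := ⌈12 / ε ^ 2⌉₊
  have hr : (0 : ℝ) < r := lt_of_lt_of_le (by positivity) hr1
  have hcut : r / p * (1 + ε / 2) ≤ fuel := by
    calc r / p * (1 + ε / 2) ≤ 13 / ε ^ 2 / p * (1 + 1 / 2) := by gcongr
      _ = 19.5 / (ε ^ 2 * p) := by ring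
      _ ≤ 20 / (ε ^ 2 * p) := by gcongr; norm_num
      _ ≤ fuel := hfuel
  refine (failProb_mono P Q _ ?_).trans ((failProb_trials_relative_le hX hp hp1
    (Nat.cast_pos.1 hr) (half_pos hε) hcut).trans (ENNReal.ofReal_le_ofReal ?_))
  · rintro N _ ⟨-, hN0, hlow, hupp⟩
    have hm : 0 < 1 - ε / 2 := by linarith
    constructor
    · rw [Real.toNNReal_le_iff_le_coe, NNReal.coe_div, NNReal.coe_natCast, NNReal.coe_natCast,
        div_le_div_iff₀ (by positivity) (Nat.cast_pos.2 hN0)]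
      calc p * (N : ℝ) ≤ p * (r / p * (1 + ε / 2)) := by gcongr
        _ = r * (1 + ε / 2) := by field_simp
    · rw [← NNReal.coe_le_coe, Real.coe_toNNReal _ (by positivity), NNReal.coe_div,
        NNReal.coe_natCast, NNReal.coe_natCast, div_le_div_iff₀ (Nat.cast_pos.2 hN0) hm]
      calc r * (1 - ε / 2) = p * (r / p * (1 - ε / 2)) := by field_simp
        _ ≤ p * N := by gcongr
  · rw [div_le_iff₀ (by positivity)] at hr1
    rw [div_le_div_iff₀ (by positivity) (by norm_num)]
    linarith

theorem failProb_bernoulliEstimator_ge_le (hX : IsExperiment P Q X p) (hp : 0 < p) (hp1 : p ≤ 1)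
    (hε : 0 < ε) (hε1 : ε < 1) {K : ℝ} (hK : 1 < K) {B : ℕ} (hB : 13 * K / (ε ^ 2 * p) ≤ B)
    (hfuel : B ≤ fuel) :
    failProb P Q (bernoulliEstimator fuel X ε) (fun x c => (p / K).toNNReal ≤ x ∧ c ≤ B) ≤
      ENNReal.ofReal (1 / (12 * (K - 1) ^ 2)) := by
  obtain ⟨hr1, hr2⟩ := le_natCeil_twelve_div_sq hε hε1
  unfold bernoulliEstimator
  rw [failProb_bind_ret]
  set r := ⌈12 / ε ^ 2⌉₊
  have hr : (0 : ℝ) < r := lt_of_lt_of_le (by positivity) hr1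
  have hK' : 0 < K - 1 := by linarith
  have hB' : r / p * (1 + (K - 1)) ≤ B := by
    calc r / p * (1 + (K - 1)) ≤ 13 / ε ^ 2 / p * (1 + (K - 1)) := by gcongr
      _ = 13 * K / (ε ^ 2 * p) := by ring
      _ ≤ B := hB
  refine (failProb_mono P Q _ ?_).trans ((failProb_trials_relative_le hX hp hp1
    (Nat.cast_pos.1 hr) hK' (hB'.trans (Nat.cast_le.2 hfuel))).trans (ENNReal.ofReal_le_ofReal ?_))
  · rintro N c ⟨rfl, hN0, -, hupp⟩
    constructor
    · rw [Real.toNNReal_le_iff_le_coe, NNReal.coe_div, NNReal.coe_natCast, NNReal.coe_natCast,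
        div_le_div_iff₀ (by positivity) (Nat.cast_pos.2 hN0)]
      calc p * (c : ℝ) ≤ p * (r / p * (1 + (K - 1))) := by gcongr
        _ = r * K := by field_simp; ring
    · exact_mod_cast hupp.trans hB'
  · have h12 : 12 ≤ 12 / ε ^ 2 := le_div_self (by norm_num) (by positivity)
      (pow_le_one₀ hε.le hε1.le)
    gcongr
    exact h12.trans hr1

variable {q : ℝ} {k : ℕ}

theorem failProb_amplify_bernoulliEstimator_mem_Icc_le (hX : IsExperiment P Q X p) (hp : 0 < p)
    (hp1 : p ≤ 1) (hε : 0 < ε) (hε1 : ε < 1) (hq : ⌈4 / (1 - q)⌉₊ = k) (hk : 40 ≤ k) {K : ℝ}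
    (hK : 2 ≤ K) {B : ℕ} (hB : 13 * K / (ε ^ 2 * p) ≤ B) (hfuel : B ≤ fuel) :
    failProb P Q (amplify q (bernoulliEstimator fuel X ε)) (fun x c => x ∈ Set.Icc
        (p / (1 + ε / 2)).toNNReal (p / (1 - ε / 2)).toNNReal ∧ c ≤ (2 * k + 1) * B) ≤
      ENNReal.ofReal ((2 * k + 1) * (1 / (12 * (K - 1) ^ 2)) + 1 / 100) := by
  have hfuel' : 20 / (ε ^ 2 * p) ≤ fuel := by
    refine le_trans ?_ (hB.trans (Nat.cast_le.2 hfuel))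
    gcongr
    linarith
  exact failProb_amplify_mem_Icc_le hq hk (by positivity)
    (failProb_bernoulliEstimator_mem_Icc_le hX hp hp1 hε hε1 hfuel')
    ((failProb_mono P Q _ fun _ _ h => h.2).trans
      (failProb_bernoulliEstimator_ge_le hX hp hp1 hε hε1 (by linarith) hB hfuel))

theorem failProb_amplify_bernoulliEstimator_ge_le (hX : IsExperiment P Q X p) (hp : 0 < p)
    (hp1 : p ≤ 1) (hε : 0 < ε) (hε1 : ε < 1) (hq : ⌈4 / (1 - q)⌉₊ = k) {K : ℝ}
    (hK : 1 < K) {B : ℕ} (hB : 13 * K / (ε ^ 2 * p) ≤ B) (hfuel : B ≤ fuel) :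
    failProb P Q (amplify q (bernoulliEstimator fuel X ε))
        (fun x c => (p / K).toNNReal ≤ x ∧ c ≤ (2 * k + 1) * B) ≤
      ENNReal.ofReal ((2 * k + 1) * (1 / (12 * (K - 1) ^ 2))) := by
  subst hq
  refine (failProb_amplify_ge
    (failProb_bernoulliEstimator_ge_le hX hp hp1 hε hε1 hK hB hfuel) q).trans_eq ?_
  rw [ENNReal.ofReal_mul (by positivity), ← ENNReal.ofReal_natCast]
  push_cast
  rfl

end Bernoulli

/-! ### Second moments of independent samples -/

theorem count_eq_sum_map_ite {U : Type*} [DecidableEq U] (l : List U) (a : U) :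
    (l.count a : ℝ) = (l.map fun b => if b = a then (1 : ℝ) else 0).sum := by
  induction l with
  | nil => simp
  | cons b l ih =>
    rw [List.count_cons, List.map_cons, List.sum_cons, ← ih]
    by_cases h : b = a <;> simp [h, add_comm]

section Iid

variable {U : Type*} [Fintype U]

/-- The expectation of `g` over lists of `m` independent samples with law `p`. -/
noncomputable def iid (p : U → ℝ) : ℕ → (List U → ℝ) → ℝ
  | 0, g => g []
  | m + 1, g => ∑ a, p a * iid p m fun l => g (a :: l)

variable {p : U → ℝ}

theorem iid_add (m : ℕ) (g g' : List U → ℝ) :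
    iid p m (fun l => g l + g' l) = iid p m g + iid p m g' := by
  induction m generalizing g g' with
  | zero => rfl
  | succ m ih => simp only [iid, ih, mul_add, Finset.sum_add_distrib]

theorem iid_mul_left (m : ℕ) (r : ℝ) (g : List U → ℝ) :
    iid p m (fun l => r * g l) = r * iid p m g := by
  induction m generalizing g with
  | zero => rfl
  | succ m ih => simp only [iid, ih, Finset.mul_sum, mul_left_comm]

theorem iid_const (hp : ∑ a, p a = 1) (m : ℕ) (r : ℝ) : iid p m (fun _ => r) = r := by
  induction m with
  | zero => rfl
  | succ m ih => simp only [iid, ih, ← Finset.sum_mul, hp, one_mul]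

theorem iid_sum {ι : Type*} (s : Finset ι) (m : ℕ) (g : ι → List U → ℝ) :
    iid p m (fun l => ∑ i ∈ s, g i l) = ∑ i ∈ s, iid p m (g i) := by
  induction m generalizing g with
  | zero => rfl
  | succ m ih =>
    simp only [iid, ih, Finset.mul_sum]
    rw [Finset.sum_comm]

theorem iid_congr (m : ℕ) {g g' : List U → ℝ}
    (h : ∀ l, l.length = m → (∀ a ∈ l, p a ≠ 0) → g l = g' l) : iid p m g = iid p m g' := by
  induction m generalizing g g' with
  | zero => exact h [] rfl (by simp)
  | succ m ih =>
    refine Finset.sum_congr rfl fun a _ => ?_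
    by_cases ha : p a = 0
    · simp [ha]
    · congr 1
      exact ih fun l hl hl' => h _ (by simp [hl]) (by simpa using ⟨ha, hl'⟩)

theorem iid_nonneg (hp : ∀ a, 0 ≤ p a) (m : ℕ) {g : List U → ℝ} (h : ∀ l, 0 ≤ g l) :
    0 ≤ iid p m g := by
  induction m generalizing g with
  | zero => exact h []
  | succ m ih => exact Finset.sum_nonneg fun a _ => mul_nonneg (hp a) (ih fun l => h _)

theorem iid_sum_sub_mean (hp : ∑ a, p a = 1) (f : U → ℝ) (m : ℕ) :
    iid p m (fun l => (l.map f).sum - m * ∑ a, p a * f a) = 0 := by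
  set μ := ∑ a, p a * f a
  induction m with
  | zero => simp [iid]
  | succ m ih =>
    have hcons (a : U) (l : List U) : ((a :: l).map f).sum - (m + 1 : ℕ) * μ =
        (f a - μ) + ((l.map f).sum - m * μ) := by
      simp only [List.map_cons, List.sum_cons]; push_cast; ring
    simp only [iid, hcons, iid_add, iid_const hp, ih, add_zero, mul_sub, Finset.sum_sub_distrib,
      ← Finset.sum_mul, hp, one_mul]
    exact sub_self μ

theorem iid_sum_variance (hp : ∑ a, p a = 1) (f : U → ℝ) (m : ℕ) :
    iid p m (fun l => ((l.map f).sum - m * ∑ a, p a * f a) ^ 2) =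
      m * ∑ a, p a * (f a - ∑ b, p b * f b) ^ 2 := by
  have hmean := iid_sum_sub_mean hp f
  set μ := ∑ a, p a * f a
  induction m with
  | zero => simp [iid]
  | succ m ih =>
    have hcons (a : U) (l : List U) : (((a :: l).map f).sum - (m + 1 : ℕ) * μ) ^ 2 =
        (f a - μ) ^ 2 + 2 * (f a - μ) * ((l.map f).sum - m * μ) + ((l.map f).sum - m * μ) ^ 2 := by
      simp only [List.map_cons, List.sum_cons]; push_cast; ring
    simp only [iid, hcons, iid_add, iid_const hp, iid_mul_left, ih, hmean, mul_zero, add_zero,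
      mul_add, Finset.sum_add_distrib, ← Finset.sum_mul, hp, one_mul]
    push_cast
    ring

theorem sum_mul_sub_sq_le (hp : ∑ a, p a = 1) (f : U → ℝ) :
    ∑ a, p a * (f a - ∑ b, p b * f b) ^ 2 ≤ ∑ a, p a * f a ^ 2 := by
  set μ := ∑ b, p b * f b with hμ
  have hexpand (a : U) :
      p a * (f a - μ) ^ 2 = p a * f a ^ 2 - 2 * μ * (p a * f a) + μ ^ 2 * p a := by ring
  simp only [hexpand, Finset.sum_add_distrib, Finset.sum_sub_distrib, ← Finset.mul_sum, hp, ← hμ]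
  linarith [sq_nonneg μ]

variable [DecidableEq U]

theorem iid_count_variance_le (hp : ∑ a, p a = 1) (m : ℕ) (a : U) :
    iid p m (fun l => (l.count a - m * p a) ^ 2) ≤ m * p a := by
  have hmean : ∑ b, p b * (if b = a then (1 : ℝ) else 0) = p a := by simp
  have hvar := iid_sum_variance hp (fun b => if b = a then (1 : ℝ) else 0) m
  simp only [← count_eq_sum_map_ite, hmean] at hvar
  rw [hvar]
  gcongr
  calc _ ≤ ∑ b, p b * (if b = a then (1 : ℝ) else 0) ^ 2 := by
        simpa only [hmean] using sum_mul_sub_sq_le hp fun b => if b = a then (1 : ℝ) else 0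
    _ = p a := by simp

/-- The number of collisions in a list of samples with law `p`, in which a collision on the item
`a` counts `1 / p a`. -/
noncomputable def collisions (p : U → ℝ) (l : List U) : ℝ :=
  ∑ a, ((l.count a).choose 2 : ℝ) / p a

theorem collisions_cons (p : U → ℝ) (a : U) (l : List U) :
    collisions p (a :: l) = collisions p l + l.count a / p a := by
  unfold collisions
  rw [← Finset.sum_erase_add _ _ (Finset.mem_univ a),
    ← Finset.sum_erase_add (a := a) _ _ (Finset.mem_univ a), add_assoc, ← add_div]
  congr 1
  · refine Finset.sum_congr rfl fun b hb => ?_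
    rw [List.count_cons_of_ne (Finset.ne_of_mem_erase hb).symm]
  · rw [List.count_cons_self, Nat.choose_succ_succ' (List.count a l) 1]
    simp [add_comm]

theorem sum_mul_count_div_sub (hp : ∑ a, p a = 1) {l : List U} (hl : ∀ a ∈ l, p a ≠ 0) :
    ∑ a, p a * (l.count a / p a - l.length) = 0 := by
  have hcount (a : U) : p a * (l.count a / p a) = l.count a := by
    by_cases ha : p a = 0
    · simp [ha, List.count_eq_zero_of_not_mem fun h => hl a h ha]
    · field_simp
  have hsum := Multiset.sum_count_eq_card (s := Finset.univ) (m := (l : Multiset U)) (by simp)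
  simp only [Multiset.coe_count, Multiset.coe_card] at hsum
  simp only [mul_sub, Finset.sum_sub_distrib, hcount, ← Finset.sum_mul, hp, one_mul]
  rw [← hsum]
  push_cast
  exact sub_self _

theorem iid_mul_count_div_sub_sq_le (hp : ∑ a, p a = 1) (h0 : ∀ a, 0 ≤ p a) (m : ℕ) (a : U) :
    iid p m (fun l => p a * (l.count a / p a - m) ^ 2) ≤ if p a = 0 then 0 else (m : ℝ) := by
  split_ifs with ha
  · rw [iid_mul_left, ha, zero_mul]
  · have hpa : 0 < p a := lt_of_le_of_ne (h0 a) (Ne.symm ha)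
    have hsq (l : List U) :
        p a * (l.count a / p a - m) ^ 2 = 1 / p a * (l.count a - m * p a) ^ 2 := by
      field_simp
    calc iid p m (fun l => p a * (l.count a / p a - m) ^ 2)
        = 1 / p a * iid p m fun l => (l.count a - m * p a) ^ 2 := by
          simp only [hsq, iid_mul_left]
      _ ≤ 1 / p a * (m * p a) := by gcongr; exact iid_count_variance_le hp m a
      _ = m := by field_simp

/-- Given the first `m` samples, the expected increment of `collisions` is always `m`; hence the
increments are uncorrelated, and their variances add up. -/
theorem iid_collisions_variance_le (hp : ∑ a, p a = 1) (h0 : ∀ a, 0 ≤ p a) (m : ℕ) :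
    iid p m (fun l => (collisions p l - m.choose 2) ^ 2) ≤
      m.choose 2 * ({a | p a ≠ 0} : Finset U).card := by
  induction m with
  | zero => simp [iid, collisions]
  | succ m ih =>
    have hchoose : ((m + 1).choose 2 : ℝ) = m.choose 2 + m := by
      rw [Nat.choose_succ_succ' m 1, Nat.choose_one_right]; push_cast; ring
    let D : List U → ℝ := fun l => collisions p l - m.choose 2
    let e : U → List U → ℝ := fun a l => l.count a / p a - m
    have hstep : iid p (m + 1) (fun l => (collisions p l - (m + 1).choose 2) ^ 2) =
        iid p m fun l => ∑ a, p a * (D l + e a l) ^ 2 := by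
      simp only [iid_sum, iid, iid_mul_left]
      refine Finset.sum_congr rfl fun a _ => congrArg _ (iid_congr m fun l _ _ => ?_)
      simp only [collisions_cons, hchoose, D, e]
      ring
    have huncorr : iid p m (fun l => ∑ a, p a * (D l + e a l) ^ 2) =
        iid p m fun l => D l ^ 2 + ∑ a, p a * e a l ^ 2 := by
      refine iid_congr m fun l hlen hl => ?_
      have he : ∑ a, p a * e a l = 0 := by
        simpa only [hlen] using sum_mul_count_div_sub hp hl
      have hexpand (a : U) : p a * (D l + e a l) ^ 2 =
          p a * D l ^ 2 + 2 * D l * (p a * e a l) + p a * e a l ^ 2 := by ring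
      simp only [hexpand, Finset.sum_add_distrib, ← Finset.sum_mul, ← Finset.mul_sum, hp, he]
      ring
    calc iid p (m + 1) (fun l => (collisions p l - (m + 1).choose 2) ^ 2)
        = iid p m (fun l => D l ^ 2) + ∑ a, iid p m fun l => p a * e a l ^ 2 := by
          rw [hstep, huncorr, iid_add, iid_sum]
      _ ≤ m.choose 2 * ({a | p a ≠ 0} : Finset U).card +
            ∑ a, if p a = 0 then 0 else (m : ℝ) :=
          add_le_add ih (Finset.sum_le_sum fun a _ => iid_mul_count_div_sub_sq_le hp h0 m a)
      _ = (m + 1).choose 2 * ({a | p a ≠ 0} : Finset U).card := by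
          rw [Finset.sum_ite, Finset.sum_const_zero, Finset.sum_const, nsmul_eq_mul, hchoose]
          ring

end Iid

/-! ### Chebyshev's inequality for independent runs -/

section Chebyshev

variable {U I α : Type*} [Fintype U] (P Q : PMF I) {X : Alg I α} {p : U → ℝ} {val : U → α}

/-- The law of the output of `X` is at most that of `val a`, where `a` has law `p`. As `X` may
abort, there need not be equality. -/
def OutputLawLE (P Q : PMF I) (X : Alg I α) (p : U → ℝ) (val : U → α) : Prop :=
  ∀ f : α → ℝ≥0∞, expect P Q X (fun o _ => o.elim 0 f) ≤ ∑ a, ENNReal.ofReal (p a) * f (val a)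

theorem OutputLawLE.expect_replicate_le (hX : OutputLawLE P Q X p val) (hp : ∀ a, 0 ≤ p a)
    (m : ℕ) (g : List α → ℝ≥0∞) (G : List U → ℝ) (hG : ∀ l, 0 ≤ G l)
    (hgG : ∀ l, l.length = m → (∀ a ∈ l, p a ≠ 0) → g (l.map val) ≤ ENNReal.ofReal (G l)) :
    expect P Q (X.replicate m) (fun o _ => o.elim 0 g) ≤ ENNReal.ofReal (iid p m G) := by
  induction m generalizing g G with
  | zero => exact hgG [] rfl (by simp)
  | succ m ih =>
    simp only [Alg.replicate, iid]
    rw [expect_bind]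
    calc _ ≤ expect P Q X (fun o _ => o.elim 0 fun x =>
          expect P Q (X.replicate m) fun o _ => o.elim 0 fun l => g (x :: l)) := by
          refine expect_mono P Q X fun o _ => ?_
          cases o with
          | none => exact le_rfl
          | some x =>
            simp only [Option.elim]
            rw [expect_bind]
            exact expect_mono P Q _ fun o _ => by cases o <;> exact le_rfl
      _ ≤ ∑ a, ENNReal.ofReal (p a) *
          expect P Q (X.replicate m) fun o _ => o.elim 0 fun l => g (val a :: l) := hX _
      _ ≤ _ := by
          rw [ENNReal.ofReal_sum_of_nonneg fun a _ =>
            mul_nonneg (hp a) (iid_nonneg hp m fun l => hG _)]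
          refine Finset.sum_le_sum fun a _ => ?_
          rw [ENNReal.ofReal_mul (hp a)]
          by_cases ha : p a = 0
          · simp [ha]
          · gcongr
            exact ih _ _ (fun l => hG _) fun l hl hsupp =>
              hgG (a :: l) (by simp [hl]) (by simpa using ⟨ha, hsupp⟩)

theorem OutputLawLE.failProb_replicate_le (hX : OutputLawLE P Q X p val) (hp : ∀ a, 0 ≤ p a)
    (m : ℕ) {G : List α → Prop} {T : List α → ℕ → Prop} {F : List U → ℝ} {μ V d : ℝ} (hd : 0 < d)
    (hV : iid p m (fun l => (F l - μ) ^ 2) ≤ V)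
    (hG : ∀ l, l.length = m → (∀ a ∈ l, p a ≠ 0) → |F l - μ| ≤ d → G (l.map val)) :
    failProb P Q (X.replicate m) (fun l c => G l ∧ T l c) ≤
      failProb P Q (X.replicate m) T + ENNReal.ofReal (V / d ^ 2) := by
  classical
  have hdev := hX.expect_replicate_le P Q hp m (fun l => if G l then 0 else 1)
    (fun l => 1 / d ^ 2 * (F l - μ) ^ 2) (fun l => by positivity) fun l hl hsupp => by
      split_ifs with h
      · exact zero_le
      · have : d ≤ |F l - μ| := (not_le.1 (mt (hG l hl hsupp) h)).le
        rw [ENNReal.one_le_ofReal, one_div_mul_eq_div, one_le_div (by positivity),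
          ← sq_abs (F l - μ)]
        gcongr
  refine (failProb_le_add_expect P Q _ fun l c hT hS => ?_).trans
    (add_le_add_right (hdev.trans (ENNReal.ofReal_le_ofReal ?_)) _)
  · rw [if_neg fun h => hS ⟨h, hT⟩]
  · rw [iid_mul_left, one_div_mul_eq_div]
    gcongr

end Chebyshev

/-! ### Heavy items -/

section Heavy

variable {U : Type*} [Fintype U]

/-- The heavy items: those at or above the threshold `θ`, when the item `a` has rank `ρ a`. -/
noncomputable def heavy (w : U → ℝ≥0) (ρ : U → ℕ) (θ : Key) : Finset U :=
  {a | θ ≤ (rankedItem w ρ a).key}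

/-- The probability that a proportional sample is heavy. -/
noncomputable def heavyMass (w : U → ℝ≥0) (ρ : U → ℕ) (θ : Key) : ℝ :=
  (∑ a ∈ heavy w ρ θ, (w a : ℝ)) / ∑ a, (w a : ℝ)

/-- The probability that a uniform sample is heavy. -/
noncomputable def heavyFraction (w : U → ℝ≥0) (ρ : U → ℕ) (θ : Key) : ℝ :=
  (heavy w ρ θ).card / Fintype.card U

variable {w : U → ℝ≥0} {ρ : U → ℕ} {θ : Key}

theorem mem_heavy {a : U} : a ∈ heavy w ρ θ ↔ θ ≤ (rankedItem w ρ a).key := by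
  simp [heavy]

theorem sum_weight_pos (hW : ∑ a, w a ≠ 0) : 0 < ∑ a, (w a : ℝ) := by
  rw [← NNReal.coe_sum, NNReal.coe_pos]
  exact pos_iff_ne_zero.2 hW

theorem heavyMass_le_one (hW : ∑ a, w a ≠ 0) : heavyMass w ρ θ ≤ 1 :=
  div_le_one_of_le₀ (Finset.sum_le_sum_of_subset_of_nonneg (Finset.subset_univ _)
    fun _ _ _ => NNReal.coe_nonneg _) (sum_weight_pos hW).le

theorem heavyFraction_le_one : heavyFraction w ρ θ ≤ 1 :=
  div_le_one_of_le₀ (Nat.cast_le.2 (Finset.card_le_univ _)) (Nat.cast_nonneg _)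

theorem heavyFraction_pos [Nonempty U] (hH : (heavy w ρ θ).Nonempty) : 0 < heavyFraction w ρ θ := by
  have := hH.card_pos
  unfold heavyFraction
  positivity

theorem propDist_apply (hW : ∑ a, w a ≠ 0) (a : U) :
    propDist w hW a = ENNReal.ofReal ((w a : ℝ) / ∑ b, (w b : ℝ)) := by
  rw [propDist, PMF.ofFintype_apply, ← NNReal.coe_sum, ← NNReal.coe_div, ENNReal.ofReal_coe_nnreal]

theorem tsum_rankedLaw_mul (R : PMF U) (f : Item U → ℝ≥0∞) :
    ∑' x, rankedLaw w ρ R x * f x = ∑ a, R a * f (rankedItem w ρ a) := by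
  rw [rankedLaw, tsum_map_mul, tsum_fintype]

theorem prob_rankedLaw (R : PMF U) :
    prob (rankedLaw w ρ R) {x | θ ≤ x.key} = (∑ a ∈ heavy w ρ θ, R a).toReal := by
  rw [prob, rankedLaw, PMF.toOuterMeasure_map_apply, PMF.toOuterMeasure_apply, tsum_fintype, heavy,
    Finset.sum_filter]
  exact congrArg _ (Finset.sum_congr rfl fun a _ => by
    by_cases h : θ ≤ (rankedItem w ρ a).key <;> simp [h])

theorem prob_propDist (hW : ∑ a, w a ≠ 0) :
    prob (rankedLaw w ρ (propDist w hW)) {x | θ ≤ x.key} = heavyMass w ρ θ := by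
  rw [prob_rankedLaw, ENNReal.toReal_sum fun a _ => PMF.apply_ne_top _ a, heavyMass,
    Finset.sum_div]
  exact Finset.sum_congr rfl fun a _ => by
    rw [propDist_apply, ENNReal.toReal_ofReal (by positivity)]

theorem prob_uniformOfFintype [Nonempty U] :
    prob (rankedLaw w ρ (PMF.uniformOfFintype U)) {x | θ ≤ x.key} =
      heavyFraction w ρ θ := by
  rw [prob_rankedLaw, heavyFraction]
  simp [div_eq_mul_inv]

end Heavy

/-! ### Rejection sampling -/

section RepeatUntil

variable {I α : Type*} {P Q : PMF I}

/-- The number of samples, with a surcharge of `L` if the algorithm aborts. -/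
noncomputable def surchargedCost (L : ℝ≥0∞) (o : Option α) (c : ℕ) : ℝ≥0∞ :=
  c + o.elim L fun _ => 0

theorem surchargedCost_add (L : ℝ≥0∞) (o : Option α) (c d : ℕ) :
    surchargedCost L o (c + d) = c + surchargedCost L o d := by
  simp [surchargedCost, add_assoc]

theorem expect_replicate_surchargedCost_le {X : Alg I α} {L e : ℝ≥0∞}
    (h : expect P Q X (surchargedCost L) ≤ e) (m : ℕ) :
    expect P Q (X.replicate m) (surchargedCost L) ≤ m * e := by
  induction m with
  | zero => simp [Alg.replicate, expect, surchargedCost]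
  | succ m ih =>
    have hrest : expect P Q ((X.replicate m).bind fun l => .ret l) (surchargedCost L) ≤ m * e := by
      rw [expect_bind]
      refine (expect_mono P Q _ fun o d => ?_).trans ih
      cases o <;> simp [expect]
    calc expect P Q (X.replicate (m + 1)) (surchargedCost L)
        ≤ expect P Q X (fun o c => surchargedCost L o c + m * e) := by
          rw [Alg.replicate, expect_bind]
          refine expect_mono P Q X fun o c => ?_
          cases o with
          | none => exact le_self_add
          | some x =>
            simp only [Option.elim, surchargedCost_add]
            rw [expect_add P Q _ (fun _ _ => (c : ℝ≥0∞)), expect_const]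
            simp only [surchargedCost, Option.elim, add_zero]
            gcongr
            rw [expect_bind] at hrest ⊢
            exact hrest
      _ ≤ e + m * e := by rw [expect_add, expect_const]; gcongr
      _ = (m + 1 : ℕ) * e := by push_cast; ring

theorem failProb_cost_le (A : Alg I α) {B : ℕ} (hB : 0 < B) {L e : ℝ≥0∞} (hL : B ≤ L)
    (h : expect P Q A (surchargedCost L) ≤ e) :
    failProb P Q A (fun _ c => c ≤ B) ≤ (B : ℝ≥0∞)⁻¹ * e := by
  have hmarkov {x : ℝ≥0∞} (hx : B ≤ x) : 1 ≤ (B : ℝ≥0∞)⁻¹ * x := by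
    rw [← ENNReal.inv_mul_cancel (Nat.cast_ne_zero.2 hB.ne') (ENNReal.natCast_ne_top B)]
    gcongr
  refine le_trans ?_ (mul_le_mul_right h _)
  rw [← expect_mul_left]
  refine expect_mono P Q A fun o c => ?_
  cases o with
  | none => exact hmarkov (hL.trans le_add_self)
  | some x =>
    by_cases hc : c ≤ B
    · simp [hc]
    · simpa [hc, surchargedCost] using hmarkov (Nat.cast_le.2 (not_le.1 hc).le)

variable {good : I → Prop} [DecidablePred good]

theorem expect_repeatUntil_succ (fuel : ℕ) (g : Option I → ℕ → ℝ≥0∞) :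
    expect P Q (repeatUntil good Alg.propSample (fuel + 1)) g =
      ∑' x, P x * if good x then g (some x) 1 else
        expect P Q (repeatUntil good Alg.propSample fuel) fun o c => g o (c + 1) := by
  simp only [repeatUntil, Alg.propSample, Alg.bind, expect]
  exact tsum_congr fun x => by split_ifs <;> simp [expect]

theorem expect_repeatUntil_surchargedCost_le {p : ℝ} (hgood : prob P {x | good x} = p) (hp : 0 < p)
    (fuel : ℕ) {L : ℝ} (hL : 0 ≤ L) :
    expect P Q (repeatUntil good Alg.propSample fuel) (surchargedCost (ENNReal.ofReal L)) ≤
      ENNReal.ofReal (1 / p + L * (1 - p) ^ fuel) := by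
  have hq : 0 ≤ 1 - p := sub_nonneg.2 (hgood ▸ prob_le_one P _)
  induction fuel with
  | zero =>
    simp only [repeatUntil, expect, surchargedCost, Nat.cast_zero, Option.elim, zero_add, pow_zero,
      mul_one]
    exact ENNReal.ofReal_le_ofReal (le_add_of_nonneg_left (by positivity))
  | succ fuel ih =>
    rw [expect_repeatUntil_succ]
    simp only [add_comm _ 1, surchargedCost_add]
    rw [expect_add P Q _ (fun _ _ => ((1 : ℕ) : ℝ≥0∞)), expect_const]
    simp only [surchargedCost, Nat.cast_one, Option.elim, add_zero]
    rw [tsum_mul_ite_eq_prob, hgood]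
    refine (add_le_add_right (mul_le_mul_right (add_le_add_right ih _) _) _).trans_eq ?_
    rw [← ENNReal.ofReal_one, ← ENNReal.ofReal_add (by norm_num) (by positivity),
      ← ENNReal.ofReal_mul hp.le, ← ENNReal.ofReal_mul hq,
      ← ENNReal.ofReal_add (by positivity) (mul_nonneg hq (by positivity)), pow_add, pow_one]
    congr 1
    field_simp
    ring

theorem natCast_mul_one_sub_pow_le {p : ℝ} (hp : 0 < p) (hp1 : p ≤ 1) (m : ℕ) :
    m * (1 - p) ^ m ≤ 1 / p := by
  have hq : 0 ≤ 1 - p := sub_nonneg.2 hp1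
  rw [le_div_iff₀ hp]
  calc m * (1 - p) ^ m * p ≤ (1 - p) ^ m * (1 + m * p) := by linarith [pow_nonneg hq m]
    _ ≤ (1 - p) ^ m * (1 + p) ^ m := by
        gcongr
        exact one_add_mul_le_pow (by linarith) m
    _ = (1 - p ^ 2) ^ m := by rw [← mul_pow]; ring
    _ ≤ 1 := pow_le_one₀ (by nlinarith) (by nlinarith)

theorem expect_repeatUntil_cost_le {p : ℝ} (hgood : prob P {x | good x} = p) (hp : 0 < p)
    (fuel : ℕ) :
    expect P Q (repeatUntil good Alg.propSample fuel) (surchargedCost fuel) ≤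
      ENNReal.ofReal (2 / p) := by
  rw [← ENNReal.ofReal_natCast]
  refine (expect_repeatUntil_surchargedCost_le hgood hp fuel (Nat.cast_nonneg fuel)).trans
    (ENNReal.ofReal_le_ofReal ?_)
  have := natCast_mul_one_sub_pow_le hp (hgood ▸ prob_le_one P _) fuel
  calc 1 / p + fuel * (1 - p) ^ fuel ≤ 1 / p + 1 / p := by gcongr
    _ = 2 / p := by ring

theorem prob_mul_expect_repeatUntil_le (fuel : ℕ) (f : I → ℝ≥0∞) :
    ENNReal.ofReal (prob P {x | good x}) *
        expect P Q (repeatUntil good Alg.propSample fuel) (fun o _ => o.elim 0 f) ≤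
      ∑' x, P x * if good x then f x else 0 := by
  induction fuel with
  | zero => simp [repeatUntil, expect]
  | succ fuel ih =>
    set p := prob P {x | good x} with hp
    set e := expect P Q (repeatUntil good Alg.propSample fuel) fun o _ => o.elim 0 f
    set T := ∑' x, P x * if good x then f x else 0
    have hsplit (x : I) : P x * (if good x then f x else e) =
        P x * (if good x then f x else 0) + P x * if good x then 0 else e := by
      split_ifs <;> simp
    calc ENNReal.ofReal p * expect P Q (repeatUntil good Alg.propSample (fuel + 1))
            (fun o _ => o.elim 0 f)
        = ENNReal.ofReal p * T + ENNReal.ofReal (1 - p) * (ENNReal.ofReal p * e) := by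
          rw [expect_repeatUntil_succ]
          change ENNReal.ofReal p * ∑' x, P x * (if good x then f x else e) = _
          simp only [hsplit]
          rw [ENNReal.tsum_add, tsum_mul_ite_eq_prob, ← hp]
          ring
      _ ≤ ENNReal.ofReal p * T + ENNReal.ofReal (1 - p) * T := by gcongr
      _ = T := by
          rw [← add_mul, ← ENNReal.ofReal_add (prob_nonneg P _) (sub_nonneg.2 (prob_le_one P _))]
          simp

end RepeatUntil

/-! ### `PropEstimator` -/

section PropEstimator

variable {U I : Type*} {P Q : PMF I} {V δ n' : ℝ}

theorem le_choose_two_natCeil_sqrt (hn' : 0 < n') (hδ : 0 < δ) :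
    12 * n' / δ ^ 2 ≤ ((⌈√(24 * n') / δ⌉₊ + 1).choose 2 : ℝ) := by
  have hm : √(24 * n') / δ ≤ ⌈√(24 * n') / δ⌉₊ := Nat.le_ceil _
  rw [Nat.cast_choose_two]
  push_cast
  calc 12 * n' / δ ^ 2 = (√(24 * n') / δ) ^ 2 / 2 := by
        rw [div_pow, Real.sq_sqrt (by positivity)]; ring
    _ ≤ (⌈√(24 * n') / δ⌉₊ : ℝ) ^ 2 / 2 := by gcongr
    _ ≤ ((⌈√(24 * n') / δ⌉₊ : ℝ) + 1) * (⌈√(24 * n') / δ⌉₊ + 1 - 1) / 2 := by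
        have : (0 : ℝ) ≤ ⌈√(24 * n') / δ⌉₊ := Nat.cast_nonneg _
        gcongr
        nlinarith

theorem ofReal_div_ofReal_mem_Icc {C Z : ℝ} (hC : 0 < C) (hV : 0 < V) (hδ : 0 ≤ δ) (hδ1 : δ < 1)
    (h : |Z - C| ≤ δ * C) :
    ENNReal.ofReal C / ENNReal.ofReal (Z / V) ∈
      Set.Icc (ENNReal.ofReal (V / (1 + δ))) (ENNReal.ofReal (V / (1 - δ))) := by
  rw [abs_le] at h
  have hδ' : 0 < 1 - δ := sub_pos.2 hδ1
  have hZ : 0 < Z := lt_of_lt_of_le (mul_pos hδ' hC) (by linarith)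
  rw [← ENNReal.ofReal_div_of_pos (div_pos hZ hV)]
  constructor <;> apply ENNReal.ofReal_le_ofReal
  · rw [div_le_div_iff₀ (by positivity) (by positivity)]
    calc V * (Z / V) = Z := by field_simp
      _ ≤ C * (1 + δ) := by linarith
  · rw [div_le_div_iff₀ (by positivity) hδ']
    calc C * (1 - δ) ≤ Z := by linarith
      _ = V * (Z / V) := by field_simp

variable [Fintype U] [DecidableEq U] {X : Alg I (Item U)} {p : U → ℝ} {val : U → Item U}

theorem sum_toFinset_eq_collisions_div (hp : ∀ a, 0 ≤ p a) (hV : 0 < V)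
    (hitem : ∀ a, (val a).item = a) (hweight : ∀ a, p a ≠ 0 → ((val a).weight : ℝ) = V * p a)
    {l : List U} (hl : ∀ a ∈ l, p a ≠ 0) :
    (∑ s ∈ ((l.map val).map fun x => (x.item, x.weight)).toFinset,
      ((((l.map val).map fun x => (x.item, x.weight)).count s).choose 2 : ℝ≥0∞) / s.2) =
        ENNReal.ofReal (collisions p l / V) := by
  have hinj : Function.Injective fun a : U => ((val a).item, (val a).weight) :=
    fun a b h => by simpa only [hitem] using congrArg Prod.fst h
  have himage : (l.map fun a => ((val a).item, (val a).weight)).toFinset =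
      l.toFinset.image fun a => ((val a).item, (val a).weight) := by
    ext; simp
  rw [List.map_map, Function.comp_def, himage, Finset.sum_image hinj.injOn, collisions,
    Finset.sum_div, ENNReal.ofReal_sum_of_nonneg
      fun a _ => div_nonneg (div_nonneg (Nat.cast_nonneg _) (hp a)) hV.le,
    ← Finset.sum_subset l.toFinset.subset_univ]
  · refine Finset.sum_congr rfl fun a ha => ?_
    have hpa := hl a (List.mem_toFinset.1 ha)
    have hpos : 0 < p a := lt_of_le_of_ne (hp a) hpa.symm
    rw [List.count_map_of_injective l _ hinj, div_div, mul_comm, ← hweight a hpa,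
      ENNReal.ofReal_div_of_pos (by rw [hweight a hpa]; positivity), ENNReal.ofReal_natCast,
      ENNReal.ofReal_coe_nnreal]
  · intro a _ ha
    rw [List.mem_toFinset] at ha
    simp [List.count_eq_zero_of_not_mem ha]

/-- The estimator sees only weights, which determine the law `p` up to the factor `V`; it therefore
estimates `V`. -/
theorem failProb_propEstimator_mem_Icc_le (hX : OutputLawLE P Q X p val) (hp : ∀ a, 0 ≤ p a)
    (hp1 : ∑ a, p a = 1) (hV : 0 < V) (hitem : ∀ a, (val a).item = a)
    (hweight : ∀ a, p a ≠ 0 → ((val a).weight : ℝ) = V * p a) (hn' : 0 < n') (hδ : 0 < δ)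
    (hδ1 : δ < 1) (hsupp : (({a | p a ≠ 0} : Finset U).card : ℝ) ≤ 2 * n') :
    failProb P Q (propEstimator X n' δ)
        (fun x _ => x ∈ Set.Icc (ENNReal.ofReal (V / (1 + δ))) (ENNReal.ofReal (V / (1 - δ)))) ≤
      failProb P Q (propEstimator X n' δ) (fun _ _ => True) + ENNReal.ofReal (1 / 6) := by
  unfold propEstimator
  rw [failProb_bind_ret, failProb_bind_ret]
  set m : ℕ := ⌈√(24 * n') / δ⌉₊ + 1
  have hC : 12 * n' / δ ^ 2 ≤ (m.choose 2 : ℝ) := le_choose_two_natCeil_sqrt hn' hδ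
  have hCpos : (0 : ℝ) < m.choose 2 := lt_of_lt_of_le (by positivity) hC
  have hcheb := hX.failProb_replicate_le P Q hp m (T := fun _ _ => True) (d := δ * m.choose 2)
    (G := fun l => (m.choose 2 : ℝ≥0∞) / ∑ s ∈ (l.map fun x => (x.item, x.weight)).toFinset,
      (((l.map fun x => (x.item, x.weight)).count s).choose 2 : ℝ≥0∞) / s.2 ∈
        Set.Icc (ENNReal.ofReal (V / (1 + δ))) (ENNReal.ofReal (V / (1 - δ))))
    (by positivity) (iid_collisions_variance_le hp1 hp m) fun l _ hl hdev => by
      rw [sum_toFinset_eq_collisions_div hp hV hitem hweight hl, ← ENNReal.ofReal_natCast]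
      exact ofReal_div_ofReal_mem_Icc hCpos hV hδ.le hδ1 hdev
  simp only [and_true] at hcheb
  refine hcheb.trans (add_le_add_right (ENNReal.ofReal_le_ofReal ?_) _)
  rw [div_le_iff₀ (by positivity)] at hC
  rw [div_le_div_iff₀ (by positivity) (by norm_num)]
  calc m.choose 2 * (({a | p a ≠ 0} : Finset U).card : ℝ) * 6 ≤ m.choose 2 * (2 * n') * 6 := by
        gcongr
    _ = m.choose 2 * (12 * n') := by ring
    _ ≤ m.choose 2 * (m.choose 2 * δ ^ 2) := by gcongr
    _ = 1 * (δ * m.choose 2) ^ 2 := by ring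

end PropEstimator

/-! ### `PropEstimator` on heavy proportional samples -/

section HeavyPropEstimator

variable {U : Type*} [Fintype U] {w : U → ℝ≥0} {hW : ∑ a, w a ≠ 0} {ρ : U → ℕ} {θ : Key}
  {Q : PMF (Item U)}

/-- The law of a proportional sample conditioned on being heavy. -/
noncomputable def heavyLaw (w : U → ℝ≥0) (ρ : U → ℕ) (θ : Key) (a : U) : ℝ :=
  if θ ≤ (rankedItem w ρ a).key then w a / ∑ b ∈ heavy w ρ θ, (w b : ℝ) else 0

theorem heavyLaw_nonneg (a : U) : 0 ≤ heavyLaw w ρ θ a := by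
  unfold heavyLaw
  split_ifs <;> positivity

theorem sum_heavy_pos (hp : 0 < heavyMass w ρ θ) : 0 < ∑ a ∈ heavy w ρ θ, (w a : ℝ) :=
  lt_of_le_of_ne (by positivity) fun h => by simp [heavyMass, ← h] at hp

theorem sum_heavyLaw (hp : 0 < heavyMass w ρ θ) : ∑ a, heavyLaw w ρ θ a = 1 := by
  unfold heavyLaw
  rw [← Finset.sum_filter, ← Finset.sum_div]
  exact div_self (sum_heavy_pos hp).ne'

theorem outputLawLE_repeatUntil (hp : 0 < heavyMass w ρ θ) (fuel : ℕ) :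
    OutputLawLE (rankedLaw w ρ (propDist w hW)) Q
      (repeatUntil (fun a : Item U => θ ≤ a.key) Alg.propSample fuel) (heavyLaw w ρ θ)
        (rankedItem w ρ) := by
  intro f
  have hV := sum_heavy_pos hp
  have h := prob_mul_expect_repeatUntil_le (P := rankedLaw w ρ (propDist w hW)) (Q := Q)
    (good := fun a : Item U => θ ≤ a.key) fuel f
  rw [prob_propDist, tsum_rankedLaw_mul] at h
  have hlaw (a : U) : propDist w hW a * (if θ ≤ (rankedItem w ρ a).key then f (rankedItem w ρ a)
      else 0) = ENNReal.ofReal (heavyMass w ρ θ) *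
        (ENNReal.ofReal (heavyLaw w ρ θ a) * f (rankedItem w ρ a)) := by
    rw [← mul_assoc, ← ENNReal.ofReal_mul hp.le, propDist_apply, heavyMass, heavyLaw]
    split_ifs
    · congr 2
      field_simp
    · simp
  simp only [hlaw, ← Finset.mul_sum] at h
  exact (ENNReal.mul_le_mul_iff_right (ENNReal.ofReal_pos.2 hp).ne' ENNReal.ofReal_ne_top).1 h

variable [DecidableEq U] {n' δ : ℝ} {fuel B : ℕ}

theorem failProb_heavy_propEstimator_cost_le (hp : 0 < heavyMass w ρ θ) (hB : 0 < B)
    (hfuel : B ≤ fuel) :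
    failProb (rankedLaw w ρ (propDist w hW)) Q
      (propEstimator (repeatUntil (fun a : Item U => θ ≤ a.key) Alg.propSample fuel) n' δ)
        (fun _ c => c ≤ B) ≤
      ENNReal.ofReal (2 * (⌈√(24 * n') / δ⌉₊ + 1) / (heavyMass w ρ θ * B)) := by
  unfold propEstimator
  rw [failProb_bind_ret]
  refine (failProb_cost_le _ hB (L := fuel) (Nat.cast_le.2 hfuel)
    (expect_replicate_surchargedCost_le
      (expect_repeatUntil_cost_le (prob_propDist hW) hp fuel) _)).trans_eq ?_
  have hB' : (0 : ℝ) < B := Nat.cast_pos.2 hB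
  rw [← ENNReal.ofReal_natCast B, ← ENNReal.ofReal_inv_of_pos hB', ← ENNReal.ofReal_natCast,
    ← ENNReal.ofReal_mul (by positivity), ← ENNReal.ofReal_mul (by positivity)]
  congr 1
  push_cast
  field_simp

theorem failProb_heavy_propEstimator_mem_Icc_le (hp : 0 < heavyMass w ρ θ) (hn' : 0 < n')
    (hδ : 0 < δ) (hδ1 : δ < 1) (hheavy : ((heavy w ρ θ).card : ℝ) ≤ 2 * n') :
    failProb (rankedLaw w ρ (propDist w hW)) Q
        (propEstimator (repeatUntil (fun a : Item U => θ ≤ a.key) Alg.propSample fuel) n' δ)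
        (fun x _ => x ∈ Set.Icc
          (ENNReal.ofReal ((∑ a ∈ heavy w ρ θ, (w a : ℝ)) / (1 + δ)))
          (ENNReal.ofReal ((∑ a ∈ heavy w ρ θ, (w a : ℝ)) / (1 - δ)))) ≤
      failProb (rankedLaw w ρ (propDist w hW)) Q
        (propEstimator (repeatUntil (fun a : Item U => θ ≤ a.key) Alg.propSample fuel) n' δ)
        (fun _ _ => True) + ENNReal.ofReal (1 / 6) := by
  have hV := sum_heavy_pos hp
  refine failProb_propEstimator_mem_Icc_le (outputLawLE_repeatUntil hp fuel) heavyLaw_nonneg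
    (sum_heavyLaw hp) hV (fun _ => rfl) (fun a ha => ?_) hn' hδ hδ1 (le_trans ?_ hheavy)
  · unfold heavyLaw at ha ⊢
    rw [if_pos (by by_contra h; simp [h] at ha)]
    simp only [rankedItem]
    field_simp
  · refine Nat.cast_le.2 (Finset.card_le_card fun a ha => mem_heavy.2 ?_)
    by_contra h
    simp [heavyLaw, h] at ha

end HeavyPropEstimator

/-! ### `HarmonicEstimator` -/

section HarmonicEstimator

variable {U : Type*} [Fintype U] {w : U → ℝ≥0} {hW : ∑ a, w a ≠ 0} {ρ : U → ℕ} {φ : Key}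

/-- The term that a sample of `a` contributes to the harmonic average. -/
noncomputable def harmonicTerm (w : U → ℝ≥0) (ρ : U → ℕ) (φ : Key) (a : U) : ℝ :=
  if φ ≤ (rankedItem w ρ a).key then (w a : ℝ)⁻¹ else 0

omit [Fintype U] in
theorem harmonicTerm_nonneg (a : U) : 0 ≤ harmonicTerm w ρ φ a := by
  unfold harmonicTerm
  split_ifs <;> positivity

omit [Fintype U] in
theorem weight_le_of_le_key {a : U} (h : φ ≤ (rankedItem w ρ a).key) : (φ.weight : ℝ) ≤ w a :=
  NNReal.coe_le_coe.2 (Prod.Lex.monotone_fst _ _ h)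

theorem sum_mul_harmonicTerm (hφ : 0 < φ.weight) :
    ∑ a, w a / (∑ b, (w b : ℝ)) * harmonicTerm w ρ φ a =
      (heavy w ρ φ).card / ∑ b, (w b : ℝ) := by
  rw [Finset.card_eq_sum_ones, Nat.cast_sum, Finset.sum_div, heavy, Finset.sum_filter]
  refine Finset.sum_congr rfl fun a _ => ?_
  unfold harmonicTerm
  split_ifs with h
  · have : (0 : ℝ) < w a := (NNReal.coe_pos.2 hφ).trans_le (weight_le_of_le_key h)
    push_cast
    field_simp
  · exact mul_zero _

theorem sum_mul_harmonicTerm_sq_le (hW : ∑ a, w a ≠ 0) (hφ : 0 < φ.weight) :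
    ∑ a, w a / (∑ b, (w b : ℝ)) * harmonicTerm w ρ φ a ^ 2 ≤
      (heavy w ρ φ).card / (φ.weight * ∑ b, (w b : ℝ)) := by
  have := sum_weight_pos hW
  have hφ' : (0 : ℝ) < φ.weight := NNReal.coe_pos.2 hφ
  rw [Finset.card_eq_sum_ones, Nat.cast_sum, Finset.sum_div, heavy, Finset.sum_filter]
  refine Finset.sum_le_sum fun a _ => ?_
  unfold harmonicTerm
  split_ifs with h
  · have hwa : (0 : ℝ) < w a := hφ'.trans_le (weight_le_of_le_key h)
    calc w a / (∑ b, (w b : ℝ)) * (w a : ℝ)⁻¹ ^ 2 = 1 / (w a * ∑ b, (w b : ℝ)) := by field_simp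
      _ ≤ (1 : ℕ) / (φ.weight * ∑ b, (w b : ℝ)) := by
          rw [Nat.cast_one]
          gcongr
          exact weight_le_of_le_key h
  · simp

omit [Fintype U] in
theorem sum_map_inv_weight (hφ : 0 < φ.weight) (l : List U) :
    ((l.map (rankedItem w ρ)).map fun a => if φ ≤ a.key then (a.weight : ℝ≥0∞)⁻¹ else 0).sum =
      ENNReal.ofReal (l.map (harmonicTerm w ρ φ)).sum := by
  induction l with
  | nil => simp
  | cons a l ih =>
    have hterm : (if φ ≤ (rankedItem w ρ a).key then (w a : ℝ≥0∞)⁻¹ else 0) =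
        ENNReal.ofReal (harmonicTerm w ρ φ a) := by
      unfold harmonicTerm
      split_ifs with h
      · have hwa : (0 : ℝ) < w a := (NNReal.coe_pos.2 hφ).trans_le (weight_le_of_le_key h)
        rw [ENNReal.ofReal_inv_of_pos hwa, ENNReal.ofReal_coe_nnreal]
      · exact ENNReal.ofReal_zero.symm
    rw [List.map_cons, List.map_cons, List.sum_cons, ih, List.map_cons, List.sum_cons,
      ENNReal.ofReal_add (harmonicTerm_nonneg a) (List.sum_nonneg (by simp [harmonicTerm_nonneg])),
      ← hterm]
    rfl

variable {Q : PMF (Item U)}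

theorem outputLawLE_propSample :
    OutputLawLE (rankedLaw w ρ (propDist w hW)) Q Alg.propSample
      (fun a => w a / ∑ b, (w b : ℝ)) (rankedItem w ρ) := by
  intro f
  simp only [Alg.propSample, expect, Option.elim, tsum_rankedLaw_mul, propDist_apply, le_refl]

theorem failProb_harmonicTerm_sum_le (hφ : 0 < φ.weight) (hH : (heavy w ρ φ).Nonempty) {δ : ℝ}
    (hδ : 0 < δ) {k : ℕ} (hk : 0 < k) {G : List (Item U) → Prop}
    (hG : ∀ l : List U, |(l.map (harmonicTerm w ρ φ)).sum -
      k * ((heavy w ρ φ).card / ∑ b, (w b : ℝ))| ≤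
        δ * (k * ((heavy w ρ φ).card / ∑ b, (w b : ℝ))) → G (l.map (rankedItem w ρ))) :
    failProb (rankedLaw w ρ (propDist w hW)) Q (Alg.propSample.replicate k)
        (fun l c => G l ∧ c ≤ k) ≤
      ENNReal.ofReal
        ((∑ b, (w b : ℝ)) / (δ ^ 2 * k * (heavy w ρ φ).card * φ.weight)) := by
  have hWpos := sum_weight_pos hW
  have : (0 : ℝ) < (heavy w ρ φ).card := Nat.cast_pos.2 hH.card_pos
  have : (0 : ℝ) < φ.weight := NNReal.coe_pos.2 hφ
  have hk' : (0 : ℝ) < k := Nat.cast_pos.2 hk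
  have hp1 : ∑ a, w a / (∑ b, (w b : ℝ)) = 1 := by rw [← Finset.sum_div, div_self hWpos.ne']
  have hvar := (iid_sum_variance hp1 (harmonicTerm w ρ φ) k).trans_le
    (mul_le_mul_of_nonneg_left ((sum_mul_sub_sq_le hp1 _).trans (sum_mul_harmonicTerm_sq_le hW hφ))
      hk'.le)
  rw [sum_mul_harmonicTerm hφ] at hvar
  refine ((outputLawLE_propSample (hW := hW)).failProb_replicate_le _ Q (fun a => by positivity) k
    (T := fun _ c => c ≤ k) (d := δ * (k * ((heavy w ρ φ).card / ∑ b, (w b : ℝ))))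
    (by positivity) hvar fun l _ _ => hG l).trans_eq ?_
  rw [failProb_replicate_propSample_eq_zero, zero_add]
  congr 1
  field_simp

variable {ε p x n W F : ℝ}

theorem div_harmonic_bounds (hε : 0 < ε) (hε1 : ε < 1) (hp : 0 < p) (hn : 0 < n) (hW : 0 < W)
    {k : ℝ} (hk : 0 < k) (hx : p / (1 + ε / 6) ≤ x) (hx' : x ≤ p / (1 - ε / 6))
    (hF : |F - k * (p * n / W)| ≤ ε / 3 * (k * (p * n / W))) :
    0 < F ∧ (1 - ε) * W / n ≤ x / (F / k) ∧ x / (F / k) ≤ (1 + ε) * W / n := by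
  have hx0 : 0 < x := lt_of_lt_of_le (by positivity) hx
  have e3 : 0 < 1 - ε / 3 := by linarith
  have e6 : 0 < 1 - ε / 6 := by linarith
  have e1 : 0 < 1 - ε := by linarith
  set μ := k * (p * n / W) with hμ
  have hμ0 : 0 < μ := by positivity
  have hF1 : (1 - ε / 3) * μ ≤ F := by linarith [(abs_le.1 hF).1]
  have hF2 : F ≤ (1 + ε / 3) * μ := by linarith [(abs_le.1 hF).2]
  have hF0 : 0 < F := lt_of_lt_of_le (by positivity) hF1
  rw [div_le_iff₀ (by positivity)] at hx
  rw [le_div_iff₀ e6] at hx'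
  rw [div_div_eq_mul_div, div_le_div_iff₀ hn hF0, div_le_div_iff₀ hF0 hn]
  refine ⟨hF0, ?_, ?_⟩
  · have h : (1 - ε) * ((1 + ε / 6) * (1 + ε / 3)) ≤ 1 := by
      nlinarith [mul_pos hε hε, mul_pos (mul_pos hε hε) hε]
    calc (1 - ε) * W * F ≤ (1 - ε) * W * ((1 + ε / 3) * μ) := by gcongr
      _ = (1 - ε) * (1 + ε / 3) * k * n * p := by rw [hμ]; field_simp
      _ ≤ (1 - ε) * (1 + ε / 3) * k * n * (x * (1 + ε / 6)) := by gcongr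
      _ = ((1 - ε) * ((1 + ε / 6) * (1 + ε / 3))) * (x * k * n) := by ring
      _ ≤ x * k * n := mul_le_of_le_one_left (by positivity) h
  · have h : 1 ≤ (1 + ε) * ((1 - ε / 6) * (1 - ε / 3)) := by
      nlinarith [mul_pos hε hε, mul_pos (mul_pos hε hε) hε, mul_pos (mul_pos hε hε) e1]
    calc x * k * n ≤ (1 + ε) * ((1 - ε / 6) * (1 - ε / 3)) * (x * k * n) :=
          le_mul_of_one_le_left (by positivity) h
      _ = (1 + ε) * (1 - ε / 3) * k * n * (x * (1 - ε / 6)) := by ring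
      _ ≤ (1 + ε) * (1 - ε / 3) * k * n * p := by gcongr
      _ = (1 + ε) * W * ((1 - ε / 3) * μ) := by rw [hμ]; field_simp
      _ ≤ (1 + ε) * W * F := by gcongr

/-- The number of samples that `HarmonicEstimator` takes for the average, if its first step
estimates the fraction of heavy items as `x`. -/
noncomputable def harmonicSampleCount (ε : ℝ) (θ' : ℝ≥0) (φ : Key) (x : ℝ) : ℕ :=
  ⌈45 * (θ' : ℝ) / ((φ.weight : ℝ) * (1 - ε / 3) * x * ε ^ 2)⌉₊

variable {θ' : ℝ≥0}

theorem le_harmonicSampleCount (hφ : 0 < φ.weight) (hε : 0 < ε) (hε1 : ε < 1) (hx : 0 < x)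
    (hx' : x ≤ p / (1 - ε / 6)) :
    45 * θ' / (φ.weight * p * ε ^ 2) ≤ harmonicSampleCount ε θ' φ x := by
  have : (0 : ℝ) < φ.weight := NNReal.coe_pos.2 hφ
  have e3 : 0 < 1 - ε / 3 := by linarith
  refine le_trans ?_ (Nat.le_ceil _)
  have h : (1 - ε / 3) * x ≤ p := by
    rw [le_div_iff₀ (by linarith)] at hx'
    nlinarith
  rw [mul_assoc (φ.weight : ℝ) (1 - ε / 3) x]
  gcongr

theorem harmonicSampleCount_le (hφ : 0 < φ.weight) (hε : 0 < ε) (hε1 : ε < 1) (hp : 0 < p)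
    (hp1 : p ≤ 1) {K : ℝ} (hK : 0 < K) (hx : p / K ≤ x) :
    (harmonicSampleCount ε θ' φ x : ℝ) ≤ (135 / 2 * K * θ' / φ.weight + 1) / (ε ^ 2 * p) := by
  have : (0 : ℝ) < φ.weight := NNReal.coe_pos.2 hφ
  have e3 : 2 / 3 ≤ 1 - ε / 3 := by linarith
  have hx0 : 0 < x := lt_of_lt_of_le (by positivity) hx
  have hone : 1 ≤ 1 / (ε ^ 2 * p) := by
    rw [one_le_div (by positivity)]
    exact mul_le_one₀ (pow_le_one₀ hε.le hε1.le) hp.le hp1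
  calc (harmonicSampleCount ε θ' φ x : ℝ)
      ≤ 45 * θ' / (φ.weight * (1 - ε / 3) * x * ε ^ 2) + 1 :=
        (Nat.ceil_lt_add_one (by positivity)).le
    _ ≤ 45 * θ' / (φ.weight * (2 / 3) * (p / K) * ε ^ 2) + 1 / (ε ^ 2 * p) := by gcongr
    _ = (135 / 2 * K * θ' / φ.weight + 1) / (ε ^ 2 * p) := by
        field_simp
        ring

theorem failProb_harmonicAverage_le (hφ : 0 < φ.weight) (hH : (heavy w ρ φ).Nonempty)
    (hε : 0 < ε) (hε1 : ε < 1) (hθ' : ∑ a, (w a : ℝ) ≤ Fintype.card U * θ') {x : ℝ≥0}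
    (hx : heavyFraction w ρ φ / (1 + ε / 6) ≤ x) (hx' : x ≤ heavyFraction w ρ φ / (1 - ε / 6)) :
    failProb (rankedLaw w ρ (propDist w hW)) Q
      (Alg.propSample.replicate (harmonicSampleCount ε θ' φ x))
      (fun l _ => (x : ℝ≥0∞) /
        ((l.map fun a => if φ ≤ a.key then (a.weight : ℝ≥0∞)⁻¹ else 0).sum /
          (harmonicSampleCount ε θ' φ x : ℝ≥0∞)) ∈ Set.Icc
            (ENNReal.ofReal ((1 - ε) * (∑ a, (w a : ℝ)) / Fintype.card U))
            (ENNReal.ofReal ((1 + ε) * (∑ a, (w a : ℝ)) / Fintype.card U))) ≤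
      ENNReal.ofReal (1 / 5) := by
  have hWpos := sum_weight_pos hW
  have hH' : (0 : ℝ) < (heavy w ρ φ).card := Nat.cast_pos.2 hH.card_pos
  have hn : (0 : ℝ) < Fintype.card U := hH'.trans_le (Nat.cast_le.2 (Finset.card_le_univ _))
  have hp0 : 0 < heavyFraction w ρ φ := div_pos hH' hn
  have : (0 : ℝ) < φ.weight := NNReal.coe_pos.2 hφ
  have hθ'0 : (0 : ℝ) < θ' := by
    by_contra! h
    nlinarith
  have hx0 : (0 : ℝ) < x := lt_of_lt_of_le (by positivity) hx
  have hk := le_harmonicSampleCount (θ' := θ') hφ hε hε1 hx0 hx'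
  set k := harmonicSampleCount ε θ' φ x
  have hk0 : (0 : ℝ) < k := lt_of_lt_of_le (by positivity) hk
  set W := ∑ a, (w a : ℝ) with hWdef
  have hmean : (heavy w ρ φ).card / W = heavyFraction w ρ φ * Fintype.card U / W := by
    rw [heavyFraction, div_mul_cancel₀ _ hn.ne']
  refine (failProb_mono _ _ _ fun _ _ h => h.1).trans ((failProb_harmonicTerm_sum_le hφ hH
    (δ := ε / 3) (by positivity) (Nat.cast_pos.1 hk0) fun l hl => ?_).trans
      (ENNReal.ofReal_le_ofReal ?_))
  · rw [hmean] at hl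
    obtain ⟨hF, hlo, hhi⟩ := div_harmonic_bounds hε hε1 hp0 hn hWpos hk0 hx hx' hl
    rw [sum_map_inv_weight hφ, ← ENNReal.ofReal_natCast, ← ENNReal.ofReal_div_of_pos hk0,
      ← ENNReal.ofReal_coe_nnreal, ← ENNReal.ofReal_div_of_pos (by positivity)]
    exact ⟨ENNReal.ofReal_le_ofReal hlo, ENNReal.ofReal_le_ofReal hhi⟩
  · rw [← hWdef]
    calc W / ((ε / 3) ^ 2 * k * (heavy w ρ φ).card * φ.weight)
        ≤ Fintype.card U * θ' / ((ε / 3) ^ 2 *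
            (45 * θ' / (φ.weight * heavyFraction w ρ φ * ε ^ 2)) *
              (heavy w ρ φ).card * φ.weight) := by gcongr
      _ = 1 / 5 := by
          unfold heavyFraction
          field_simp
          norm_num

theorem natCeil_amplify_nine_tenths : ⌈4 / (1 - (9 / 10 : ℝ))⌉₊ = 40 := by
  rw [show (4 / (1 - (9 / 10 : ℝ))) = ((40 : ℕ) : ℝ) by norm_num, Nat.ceil_natCast]

variable [Nonempty U] {fuel B₁ B₂ : ℕ}

theorem failProb_harmonicEstimator_cost_le (hφ : 0 < φ.weight) (hH : (heavy w ρ φ).Nonempty)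
    (hε : 0 < ε) (hε1 : ε < 1)
    (hB₁ : 13 * 301 / ((ε / 3) ^ 2 * heavyFraction w ρ φ) ≤ B₁) (hfuel : B₁ ≤ fuel)
    (hB₂ : (135 / 2 * 301 * θ' / φ.weight + 1) / (ε ^ 2 * heavyFraction w ρ φ) ≤ B₂) :
    failProb (rankedLaw w ρ (propDist w hW)) (rankedLaw w ρ (PMF.uniformOfFintype U))
      (harmonicEstimator fuel ε θ' φ) (fun _ c => c ≤ 81 * B₁ + B₂) ≤
        ENNReal.ofReal (1 / 10000) := by
  have hX := isExperiment_unifSample (rankedLaw w ρ (propDist w hW))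
    (rankedLaw w ρ (PMF.uniformOfFintype U)) fun x => φ ≤ x.key
  rw [prob_uniformOfFintype] at hX
  have hp0 : 0 < heavyFraction w ρ φ := heavyFraction_pos hH
  have hfirst := failProb_amplify_bernoulliEstimator_ge_le hX hp0 heavyFraction_le_one
    (by positivity) (by linarith : ε / 3 < 1) natCeil_amplify_nine_tenths (K := 301)
    (by norm_num) hB₁ hfuel
  unfold harmonicEstimator
  refine (failProb_bind_le _ _ _ _ _ _ hfirst (δ' := 0) fun x c hx => ?_).trans ?_
  · rw [failProb_bind_ret]
    refine (failProb_mono _ _ _ fun l d hd => ?_).trans_eq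
      (failProb_replicate_propSample_eq_zero _ _ (harmonicSampleCount ε θ' φ x))
    have hcount : harmonicSampleCount ε θ' φ x ≤ B₂ := Nat.cast_le.1
      ((harmonicSampleCount_le hφ hε hε1 hp0 heavyFraction_le_one (by norm_num)
        (Real.toNNReal_le_iff_le_coe.1 hx.1)).trans hB₂)
    have := hx.2
    omega
  · rw [add_zero]
    exact ENNReal.ofReal_le_ofReal (by norm_num)

theorem failProb_harmonicEstimator_mem_Icc_le (hφ : 0 < φ.weight) (hH : (heavy w ρ φ).Nonempty)
    (hε : 0 < ε) (hε1 : ε < 1) (hθ' : ∑ a, (w a : ℝ) ≤ Fintype.card U * θ')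
    (hfuel : 13 * 301 / ((ε / 3) ^ 2 * heavyFraction w ρ φ) ≤ fuel) :
    failProb (rankedLaw w ρ (propDist w hW)) (rankedLaw w ρ (PMF.uniformOfFintype U))
      (harmonicEstimator fuel ε θ' φ) (fun x _ => x ∈ Set.Icc
        (ENNReal.ofReal ((1 - ε) * (∑ a, (w a : ℝ)) / Fintype.card U))
        (ENNReal.ofReal ((1 + ε) * (∑ a, (w a : ℝ)) / Fintype.card U))) ≤
      ENNReal.ofReal (1 / 3) := by
  have hX := isExperiment_unifSample (rankedLaw w ρ (propDist w hW))
    (rankedLaw w ρ (PMF.uniformOfFintype U)) fun x => φ ≤ x.key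
  rw [prob_uniformOfFintype] at hX
  have hp0 : 0 < heavyFraction w ρ φ := heavyFraction_pos hH
  have hfirst := failProb_amplify_bernoulliEstimator_mem_Icc_le hX hp0 heavyFraction_le_one
    (by positivity) (by linarith : ε / 3 < 1) natCeil_amplify_nine_tenths le_rfl (K := 301)
    (by norm_num) hfuel le_rfl
  unfold harmonicEstimator
  refine (failProb_bind_le _ _ _ _ _ _ hfirst (δ' := ENNReal.ofReal (1 / 5))
    fun x c hx => ?_).trans ?_
  · obtain ⟨⟨hlo, hhi⟩, -⟩ := hx
    have hε6 : 0 < 1 - ε / 3 / 2 := by linarith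
    rw [Real.toNNReal_le_iff_le_coe] at hlo
    rw [← NNReal.coe_le_coe, Real.coe_toNNReal _ (by positivity)] at hhi
    rw [show ε / 3 / 2 = ε / 6 by ring] at hlo hhi
    rw [failProb_bind_ret]
    exact failProb_harmonicAverage_le hφ hH hε hε1 hθ' hlo hhi
  · rw [← ENNReal.ofReal_add (by norm_num) (by norm_num)]
    exact ENNReal.ofReal_le_ofReal (by norm_num)

end HarmonicEstimator

/-! ### The threshold -/

section Threshold

variable {I : Type*} (P Q : PMF I) (G : I → Prop) [DecidablePred G] (m k : ℕ)

theorem failProb_unifSample_countP_lt_le :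
    failProb P Q (Alg.unifSample.replicate m)
        (fun l c => l.length = m ∧ c ≤ m ∧ l.countP (G ·) < k) ≤
      ENNReal.ofReal (Real.exp (m * prob Q {x | G x}) / 2 ^ k) := by
  have hcost : failProb P Q (Alg.unifSample : Alg I I) (fun _ c => c ≤ 1) ≤ 0 := by
    simp [failProb, Alg.unifSample, expect]
  have hchernoff := failProb_replicate_countP_lt hcost G one_le_two ENNReal.ofNat_ne_top m k
  simp only [mul_one, mul_zero, zero_add] at hchernoff
  refine hchernoff.trans ?_
  have hmoment : (expect P Q Alg.unifSample fun o _ => o.elim 0 fun x => if G x then 2 else 1) ≤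
      ENNReal.ofReal (Real.exp (prob Q {x | G x})) := by
    simp only [Alg.unifSample, expect, Option.elim]
    rw [tsum_mul_ite_eq_prob, mul_one, ← ENNReal.ofReal_ofNat,
      ← ENNReal.ofReal_mul (prob_nonneg Q _), ← ENNReal.ofReal_add
        (mul_nonneg (prob_nonneg Q _) zero_le_two) (sub_nonneg.2 (prob_le_one Q _))]
    exact ENNReal.ofReal_le_ofReal (by linarith [Real.add_one_le_exp (prob Q {x | G x})])
  calc _ ≤ 2⁻¹ ^ k * ENNReal.ofReal (Real.exp (prob Q {x | G x})) ^ m := by gcongr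
    _ = ENNReal.ofReal (Real.exp (m * prob Q {x | G x}) / 2 ^ k) := by
      rw [ENNReal.ofReal_div_of_pos (by positivity), Real.exp_nat_mul,
        ENNReal.ofReal_pow (Real.exp_nonneg _), ENNReal.ofReal_pow zero_le_two,
        ENNReal.ofReal_ofNat, mul_comm, div_eq_mul_inv, ENNReal.inv_pow]

theorem failProb_unifSample_le_countP_le :
    failProb P Q (Alg.unifSample.replicate m)
        (fun l c => l.length = m ∧ c ≤ m ∧ k ≤ l.countP (G ·)) ≤
      ENNReal.ofReal (2 ^ k * Real.exp (-(m * (prob Q {x | G x} / 2)))) := by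
  have hcost : failProb P Q (Alg.unifSample : Alg I I) (fun _ c => c ≤ 1) ≤ 0 := by
    simp [failProb, Alg.unifSample, expect]
  have hchernoff := failProb_replicate_le_countP hcost G (r := 2⁻¹)
    (ENNReal.inv_le_one.2 one_le_two) (by simp) m k
  simp only [mul_one, mul_zero, zero_add, inv_inv] at hchernoff
  refine hchernoff.trans ?_
  have hmoment :
      (expect P Q Alg.unifSample fun o _ => o.elim 0 fun x => if G x then 2⁻¹ else 1) ≤
        ENNReal.ofReal (Real.exp (-(prob Q {x | G x} / 2))) := by
    have hhalf : (2⁻¹ : ℝ≥0∞) = ENNReal.ofReal 2⁻¹ := by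
      rw [ENNReal.ofReal_inv_of_pos two_pos, ENNReal.ofReal_ofNat]
    simp only [Alg.unifSample, expect, Option.elim]
    rw [tsum_mul_ite_eq_prob, mul_one, hhalf, ← ENNReal.ofReal_mul (prob_nonneg Q _),
      ← ENNReal.ofReal_add (mul_nonneg (prob_nonneg Q _) (by norm_num))
        (sub_nonneg.2 (prob_le_one Q _))]
    exact ENNReal.ofReal_le_ofReal
      (by linarith [Real.add_one_le_exp (-(prob Q {x | G x} / 2))])
  calc _ ≤ 2 ^ k * ENNReal.ofReal (Real.exp (-(prob Q {x | G x} / 2))) ^ m := by gcongr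
    _ = ENNReal.ofReal (2 ^ k * Real.exp (-(m * (prob Q {x | G x} / 2)))) := by
      rw [ENNReal.ofReal_mul (by positivity), ← mul_neg, Real.exp_nat_mul,
        ENNReal.ofReal_pow (Real.exp_nonneg _), ENNReal.ofReal_pow zero_le_two,
        ENNReal.ofReal_ofNat]

variable {U : Type*} {w : U → ℝ≥0} {ρ : U → ℕ} {θ : Key} {k m t : ℕ} {l : List (Item U)}

theorem key_rankedItem_injective (hρ : ρ.Injective) :
    Function.Injective fun a => (rankedItem w ρ a).key :=
  fun _ _ h => hρ (congrArg (fun κ : Key => (ofLex κ).2) h)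

variable [Fintype U]

theorem heavy_antitone : Antitone (heavy w ρ) :=
  fun _ _ h _ ha => mem_heavy.2 (h.trans (mem_heavy.1 ha))

theorem exists_card_heavy_eq (w : U → ℝ≥0) (hρ : ρ.Injective) (ht : t ≤ Fintype.card U) :
    ∃ θ, (heavy w ρ θ).card = t := by
  classical
  induction t with
  | zero =>
    obtain ⟨M, hM⟩ := (Set.finite_range fun a => (rankedItem w ρ a).key).bddAbove
    obtain ⟨θ, hθ⟩ := exists_gt M
    refine ⟨θ, Finset.card_eq_zero.2 (Finset.eq_empty_of_forall_notMem fun a ha => ?_)⟩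
    exact (hθ.trans_le (mem_heavy.1 ha)).not_ge (hM (Set.mem_range_self a))
  | succ t ih =>
    obtain ⟨θ, hθ⟩ := ih (by omega)
    have hne : (heavy w ρ θ)ᶜ.Nonempty := by
      rw [← Finset.card_pos, Finset.card_compl]
      omega
    obtain ⟨a, ha, hmax⟩ := Finset.exists_max_image _ (fun a => (rankedItem w ρ a).key) hne
    rw [Finset.mem_compl] at ha
    have hlt : (rankedItem w ρ a).key < θ := not_le.1 fun h => ha (mem_heavy.2 h)
    have hinsert : heavy w ρ (rankedItem w ρ a).key = insert a (heavy w ρ θ) := by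
      ext b
      rw [Finset.mem_insert, mem_heavy]
      constructor
      · intro hb
        by_contra! hab
        exact hab.1 (key_rankedItem_injective hρ
          ((hmax b (Finset.mem_compl.2 hab.2)).antisymm hb))
      · rintro (rfl | hb)
        · exact le_rfl
        · exact hlt.le.trans (mem_heavy.1 hb)
    exact ⟨_, by rw [hinsert, Finset.card_insert_of_notMem ha, hθ]⟩

theorem card_heavy_kthLargest_le (hk : 0 < k) (hcount : k ≤ l.countP (θ ≤ ·.key)) :
    (heavy w ρ (kthLargest k (l.map Item.key))).card ≤ (heavy w ρ θ).card := by
  refine Finset.card_le_card (heavy_antitone ?_)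
  rw [← Set.mem_Ici, kthLargest_mem_iff (isUpperSet_Ici θ) hk
    (by simpa using hcount.trans List.countP_le_length), List.countP_map]
  exact hcount

theorem card_heavy_le_card_heavy_kthLargest (hk : 0 < k) (hkl : k ≤ l.length)
    (hcount : l.countP (θ ≤ ·.key) < k) :
    (heavy w ρ θ).card ≤ (heavy w ρ (kthLargest k (l.map Item.key))).card := by
  refine Finset.card_le_card (heavy_antitone (le_of_not_ge fun h => hcount.not_ge ?_))
  rw [← Set.mem_Ici, kthLargest_mem_iff (isUpperSet_Ici θ) hk (by simpa using hkl),
    List.countP_map] at h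
  exact h

variable [Nonempty U] {P : PMF (Item U)}

theorem failProb_card_heavy_kthLargest_le_le (hρ : ρ.Injective) (hk : 0 < k)
    (ht : t ≤ Fintype.card U) :
    failProb P (rankedLaw w ρ (PMF.uniformOfFintype U)) (Alg.unifSample.replicate m)
        (fun l c => (heavy w ρ (kthLargest k (l.map Item.key))).card ≤ t ∧ c ≤ m) ≤
      ENNReal.ofReal (2 ^ k * Real.exp (-(m * ((t / Fintype.card U : ℝ) / 2)))) := by
  obtain ⟨κ, rfl⟩ := exists_card_heavy_eq w hρ ht
  have hcount := failProb_unifSample_le_countP_le P (rankedLaw w ρ (PMF.uniformOfFintype U))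
    (κ ≤ ·.key) m k
  rw [prob_uniformOfFintype] at hcount
  exact (failProb_mono _ _ _ fun l c h => ⟨card_heavy_kthLargest_le hk h.2.2, h.2.1⟩).trans hcount

theorem failProb_le_card_heavy_kthLargest_le (hρ : ρ.Injective) (hk : 0 < k) (hkm : k ≤ m)
    (ht : t ≤ Fintype.card U) :
    failProb P (rankedLaw w ρ (PMF.uniformOfFintype U)) (Alg.unifSample.replicate m)
        (fun l c => t ≤ (heavy w ρ (kthLargest k (l.map Item.key))).card ∧ c ≤ m) ≤
      ENNReal.ofReal (Real.exp (m * (t / Fintype.card U : ℝ)) / 2 ^ k) := by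
  obtain ⟨κ, rfl⟩ := exists_card_heavy_eq w hρ ht
  have hcount := failProb_unifSample_countP_lt_le P (rankedLaw w ρ (PMF.uniformOfFintype U))
    (κ ≤ ·.key) m k
  rw [prob_uniformOfFintype] at hcount
  exact (failProb_mono _ _ _ fun l c h =>
    ⟨card_heavy_le_card_heavy_kthLargest hk (h.1.symm ▸ hkm) h.2.2, h.2.1⟩).trans hcount

theorem two_pow_mul_exp_neg_le {y : ℝ} (hy : 236 ≤ y) :
    2 ^ 180 * Real.exp (-y) ≤ 1 / 200 := by
  have htwo : (2 : ℝ) ≤ Real.exp 1 := by linarith [Real.add_one_le_exp (1 : ℝ)]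
  calc 2 ^ 180 * Real.exp (-y) ≤ 2 ^ 180 * Real.exp (-(236 : ℕ)) := by
        gcongr
        exact_mod_cast hy
    _ = 2 ^ 180 * (Real.exp 1 ^ 236)⁻¹ := by rw [Real.exp_neg, ← Real.exp_nat_mul, mul_one]
    _ ≤ 2 ^ 180 * (2 ^ 236)⁻¹ := by gcongr
    _ ≤ 1 / 200 := by norm_num

theorem exp_div_two_pow_le {y : ℝ} (hy : y ≤ 68) : Real.exp y / 2 ^ 180 ≤ 1 / 200 := by
  have hthree : Real.exp 1 ≤ 3 := Real.exp_one_lt_three.le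
  calc Real.exp y / 2 ^ 180 ≤ Real.exp (68 : ℕ) / 2 ^ 180 := by
        gcongr
        exact_mod_cast hy
    _ = Real.exp 1 ^ 68 / 2 ^ 180 := by rw [← Real.exp_nat_mul, mul_one]
    _ ≤ 3 ^ 68 / 2 ^ 180 := by gcongr
    _ ≤ 1 / 200 := by norm_num

variable {x : ℝ}

theorem failProb_card_heavy_kthLargest_le_four_mul (hρ : ρ.Injective) (hx : 4 ≤ x)
    (hxU : 16 * x ≤ Fintype.card U) :
    failProb P (rankedLaw w ρ (PMF.uniformOfFintype U)) (Alg.unifSample.replicate ⌈120 * x⌉₊)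
        (fun l c => ((heavy w ρ (kthLargest 180 (l.map Item.key))).card : ℝ) ≤
          4 * Fintype.card U / x ∧ c ≤ ⌈120 * x⌉₊) ≤ ENNReal.ofReal (1 / 200) := by
  set n : ℝ := (Fintype.card U : ℝ)
  have hx₀ : 0 < x := by linarith
  have hn : 0 < n := by linarith
  have ht : ⌊4 * n / x⌋₊ ≤ Fintype.card U := by
    refine Nat.floor_le_of_le ?_
    rw [div_le_iff₀ hx₀]
    nlinarith
  have hmean : 236 ≤ ⌈120 * x⌉₊ * ((⌊4 * n / x⌋₊ / n : ℝ) / 2) := by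
    have hfraction : 4 / x - 1 / n ≤ ⌊4 * n / x⌋₊ / n := by
      rw [le_div_iff₀ hn]
      calc (4 / x - 1 / n) * n = 4 * n / x - 1 := by field_simp
        _ ≤ _ := (Nat.sub_one_lt_floor _).le
    have hxn : x / n ≤ 1 / 16 := by rw [div_le_div_iff₀ hn (by norm_num)]; linarith
    calc (236 : ℝ) ≤ 120 * x * (4 / x - 1 / n) / 2 := by
          have : 120 * x * (4 / x - 1 / n) = 480 - 120 * (x / n) := by field_simp; ring
          linarith
      _ ≤ 120 * x * (⌊4 * n / x⌋₊ / n) / 2 := by gcongr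
      _ ≤ ⌈120 * x⌉₊ * (⌊4 * n / x⌋₊ / n) / 2 := by gcongr; exact Nat.le_ceil _
      _ = _ := by ring
  refine (failProb_mono _ _ _ fun l c h => ⟨?_, h.2⟩).trans
    ((failProb_card_heavy_kthLargest_le_le hρ (by norm_num) ht).trans
      (ENNReal.ofReal_le_ofReal (two_pow_mul_exp_neg_le hmean)))
  exact (Nat.cast_le.2 h.1).trans (Nat.floor_le (by positivity))

theorem failProb_div_two_mul_le_card_heavy_kthLargest (hρ : ρ.Injective) (hx : 4 ≤ x)
    (hxU : 16 * x ≤ Fintype.card U) :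
    failProb P (rankedLaw w ρ (PMF.uniformOfFintype U)) (Alg.unifSample.replicate ⌈120 * x⌉₊)
        (fun l c => Fintype.card U / (2 * x) ≤
          ((heavy w ρ (kthLargest 180 (l.map Item.key))).card : ℝ) ∧ c ≤ ⌈120 * x⌉₊) ≤
      ENNReal.ofReal (1 / 200) := by
  set n : ℝ := (Fintype.card U : ℝ)
  have : 0 < x := by linarith
  have hn : 0 < n := by linarith
  have ht : ⌈n / (2 * x)⌉₊ ≤ Fintype.card U := by
    refine Nat.ceil_le.2 ?_
    rw [div_le_iff₀ (by positivity)]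
    exact le_mul_of_one_le_right hn.le (by linarith)
  have hm : 180 ≤ ⌈120 * x⌉₊ := by
    refine (Nat.cast_le (α := ℝ)).1 (le_trans ?_ (Nat.le_ceil (120 * x)))
    norm_num
    linarith
  have hmean : ⌈120 * x⌉₊ * (⌈n / (2 * x)⌉₊ / n : ℝ) ≤ 68 := by
    have hfraction : (⌈n / (2 * x)⌉₊ / n : ℝ) ≤ 1 / (2 * x) + 1 / n := by
      rw [div_le_iff₀ hn]
      calc (⌈n / (2 * x)⌉₊ : ℝ) ≤ n / (2 * x) + 1 := (Nat.ceil_lt_add_one (by positivity)).le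
        _ = (1 / (2 * x) + 1 / n) * n := by field_simp
    have hxn : x / n ≤ 1 / 16 := by rw [div_le_div_iff₀ hn (by norm_num)]; linarith
    have hinv_x : 1 / x ≤ 1 / 4 := one_div_le_one_div_of_le (by norm_num) hx
    have hinv_n : 1 / n ≤ 1 / 64 := one_div_le_one_div_of_le (by norm_num) (by linarith)
    calc ⌈120 * x⌉₊ * (⌈n / (2 * x)⌉₊ / n : ℝ) ≤ (120 * x + 1) * (1 / (2 * x) + 1 / n) := by
          gcongr
          exact (Nat.ceil_lt_add_one (by positivity)).le
      _ = 60 + 120 * (x / n) + 1 / x / 2 + 1 / n := by field_simp; ring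
      _ ≤ 68 := by linarith
  exact (failProb_mono _ _ _ fun l c h => ⟨Nat.ceil_le.1 h.1, h.2⟩).trans
    ((failProb_le_card_heavy_kthLargest_le hρ (by norm_num) hm ht).trans
      (ENNReal.ofReal_le_ofReal (exp_div_two_pow_le hmean)))

theorem failProb_findThreshold_le {ε : ℝ} (hρ : ρ.Injective)
    (hx : (Fintype.card U : ℝ) ^ (1 / 3 : ℝ) * ε ^ (2 / 3 : ℝ) = x) (hx4 : 4 ≤ x)
    (hxU : 16 * x ≤ Fintype.card U) :
    failProb P (rankedLaw w ρ (PMF.uniformOfFintype U)) (findThreshold (Fintype.card U) ε)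
        (fun θ c => (Fintype.card U / (2 * x) ≤ ((heavy w ρ θ).card : ℝ) ∧
          ((heavy w ρ θ).card : ℝ) ≤ 4 * Fintype.card U / x) ∧ c ≤ ⌈120 * x⌉₊) ≤
      ENNReal.ofReal (1 / 100) := by
  unfold findThreshold
  rw [failProb_bind_ret, mul_assoc, hx]
  calc _ ≤ _ := failProb_mono _ _ _ fun l c h => ⟨⟨h.1.1, h.2.1⟩, h.1.2⟩
    _ ≤ _ := failProb_and_le _ _ _ _ _
    _ ≤ ENNReal.ofReal (1 / 200) + ENNReal.ofReal (1 / 200) :=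
      add_le_add (failProb_div_two_mul_le_card_heavy_kthLargest hρ hx4 hxU)
        (failProb_card_heavy_kthLargest_le_four_mul hρ hx4 hxU)
    _ = ENNReal.ofReal (1 / 100) := by
      rw [← ENNReal.ofReal_add (by norm_num) (by norm_num)]
      norm_num

end Threshold

/-! ### The two branches -/

section Branches

variable {U : Type*} [Fintype U] {w : U → ℝ≥0} {hW : ∑ a, w a ≠ 0} {ρ : U → ℕ} {θ : Key}

theorem card_mul_weight_le_sum_heavy :
    (heavy w ρ θ).card * (θ.weight : ℝ) ≤ ∑ a ∈ heavy w ρ θ, (w a : ℝ) := by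
  rw [← nsmul_eq_mul]
  exact Finset.card_nsmul_le_sum _ _ _ fun a ha => weight_le_of_le_key (mem_heavy.1 ha)

theorem sum_sub_sum_heavy_le :
    ∑ a, (w a : ℝ) - ∑ a ∈ heavy w ρ θ, (w a : ℝ) ≤
      (Fintype.card U - (heavy w ρ θ).card) * (θ.weight : ℝ) := by
  classical
  rw [← Finset.sum_add_sum_compl (heavy w ρ θ), add_sub_cancel_left,
    ← Nat.cast_sub (Finset.card_le_univ _), ← Finset.card_compl, ← nsmul_eq_mul]
  refine Finset.sum_le_card_nsmul _ _ _ fun a ha => ?_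
  rw [Finset.mem_compl, mem_heavy, not_le] at ha
  exact NNReal.coe_le_coe.2 (Prod.Lex.monotone_fst _ _ ha.le)

theorem heavyFraction_le_heavyMass [Nonempty U] (hW : ∑ a, w a ≠ 0) :
    heavyFraction w ρ θ ≤ heavyMass w ρ θ := by
  have hcard : ((heavy w ρ θ).card : ℝ) ≤ Fintype.card U := Nat.cast_le.2 (Finset.card_le_univ _)
  have hlight := mul_le_mul_of_nonneg_left (sum_sub_sum_heavy_le (w := w) (ρ := ρ) (θ := θ))
    (Nat.cast_nonneg (α := ℝ) (heavy w ρ θ).card)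
  have hheavy := mul_le_mul_of_nonneg_left (card_mul_weight_le_sum_heavy (w := w) (ρ := ρ) (θ := θ))
    (sub_nonneg.2 hcard)
  rw [heavyFraction, heavyMass, div_le_div_iff₀ (Nat.cast_pos.2 Fintype.card_pos)
    (sum_weight_pos hW)]
  linarith

theorem one_sub_heavyMass_mul_sum_le (hW : ∑ a, w a ≠ 0) :
    (1 - heavyMass w ρ θ) * ∑ a, (w a : ℝ) ≤ Fintype.card U * θ.weight := by
  rw [heavyMass, sub_mul, one_mul, div_mul_cancel₀ _ (sum_weight_pos hW).ne']
  refine sum_sub_sum_heavy_le.trans ?_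
  gcongr
  simp

theorem natCeil_amplify_nineteen_twentieths : ⌈4 / (1 - (19 / 20 : ℝ))⌉₊ = 80 := by
  rw [show (4 / (1 - (19 / 20 : ℝ))) = ((80 : ℕ) : ℝ) by norm_num, Nat.ceil_natCast]

theorem isApprox_div {ε p W : ℝ} {W' p' : ℝ≥0} {z : ℝ≥0∞} (hε : 0 < ε) (hε1 : ε < 1)
    (hW : p * W' = W) (hp' : 0 < p') (hlo : p ≤ (1 + ε / 6) * p') (hhi : (1 - ε / 6) * p' ≤ p)
    (hz : z ∈ Set.Icc (ENNReal.ofReal (W / (1 + ε / 3))) (ENNReal.ofReal (W / (1 - ε / 3)))) :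
    IsApprox ε W' (z / p') := by
  have hp₀ : (0 : ℝ) < p' := NNReal.coe_pos.2 hp'
  have hε3 : 0 < 1 - ε / 3 := by linarith
  have hlower : (1 - ε) * (1 + ε / 3) ≤ 1 - ε / 6 := by nlinarith
  have hupper : 1 + ε / 6 ≤ (1 + ε) * (1 - ε / 3) := by nlinarith
  rw [← ENNReal.ofReal_coe_nnreal (p := p')]
  constructor
  · refine le_trans (ENNReal.ofReal_le_ofReal ?_)
      ((ENNReal.ofReal_div_of_pos hp₀).trans_le (ENNReal.div_le_div_right hz.1 _))
    rw [div_div, le_div_iff₀ (by positivity), ← hW]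
    calc (1 - ε) * W' * ((1 + ε / 3) * p') = (1 - ε) * (1 + ε / 3) * (p' * W') := by ring
      _ ≤ (1 - ε / 6) * (p' * W') := by gcongr
      _ = (1 - ε / 6) * p' * W' := by ring
      _ ≤ p * W' := by gcongr
  · refine le_trans (ENNReal.div_le_div_right hz.2 _)
      ((ENNReal.ofReal_div_of_pos hp₀).symm.trans_le (ENNReal.ofReal_le_ofReal ?_))
    rw [div_div, div_le_iff₀ (by positivity), ← hW]
    calc p * W' ≤ (1 + ε / 6) * p' * W' := by gcongr
      _ = (1 + ε / 6) * (p' * W') := by ring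
      _ ≤ (1 + ε) * (1 - ε / 3) * (p' * W') := by gcongr
      _ = (1 + ε) * W' * ((1 - ε / 3) * p') := by ring

theorem isApprox_natCast_mul {ε : ℝ} {n : ℕ} {W : ℝ≥0} {z : ℝ≥0∞} (hn : n ≠ 0)
    (hz : z ∈ Set.Icc (ENNReal.ofReal ((1 - ε) * W / n)) (ENNReal.ofReal ((1 + ε) * W / n))) :
    IsApprox ε W (n * z) := by
  have hscale (r : ℝ) : (n : ℝ≥0∞) * ENNReal.ofReal (r / n) = ENNReal.ofReal r := by
    rw [← ENNReal.ofReal_natCast, ← ENNReal.ofReal_mul n.cast_nonneg,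
      mul_div_cancel₀ _ (Nat.cast_ne_zero.2 hn)]
  exact ⟨(hscale _).symm.trans_le (mul_le_mul_right hz.1 _),
    (mul_le_mul_right hz.2 _).trans_eq (hscale _)⟩

variable [DecidableEq U] {Q : PMF (Item U)} {ε n' : ℝ} {fuel B : ℕ} {p' : ℝ≥0}

theorem failProb_propBranch_le (hε : 0 < ε) (hε1 : ε < 1) (hn' : 0 < n')
    (hheavy : ((heavy w ρ θ).card : ℝ) ≤ 2 * n')
    (hB : 24000 * (⌈√(24 * n') / (ε / 3)⌉₊ + 1 : ℝ) ≤ B) (hfuel : B ≤ fuel) (hp' : 1 / 2 ≤ p')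
    (hlo : heavyMass w ρ θ ≤ (1 + ε / 6) * p') (hhi : (1 - ε / 6) * p' ≤ heavyMass w ρ θ) :
    failProb (rankedLaw w ρ (propDist w hW)) Q
        ((amplify (19 / 20) (propEstimator
          (repeatUntil (fun a : Item U => θ ≤ a.key) Alg.propSample fuel) n' (ε / 3))).bind
            fun Wθ => .ret (Wθ / (p' : ℝ≥0∞)))
        (fun x c => IsApprox ε (∑ a, w a) x ∧ c ≤ 161 * B) ≤ ENNReal.ofReal (1 / 20) := by
  have : (1 / 2 : ℝ) ≤ p' := by exact_mod_cast hp'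
  have hp : 5 / 12 ≤ heavyMass w ρ θ := by nlinarith
  have hp₀ : 0 < heavyMass w ρ θ := by linarith
  have hB₀ : (0 : ℝ) < B := lt_of_lt_of_le (by positivity) hB
  have hcost := (failProb_heavy_propEstimator_cost_le (hW := hW) (Q := Q) (n' := n') (δ := ε / 3)
    hp₀ (Nat.cast_pos.1 hB₀) hfuel).trans (ENNReal.ofReal_le_ofReal (q := 1 / 5000) (by
      rw [div_le_div_iff₀ (by positivity) (by norm_num)]
      nlinarith))
  have hgood := (failProb_heavy_propEstimator_mem_Icc_le (hW := hW) (Q := Q) (fuel := fuel) hp₀ hn'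
    (by linarith : 0 < ε / 3) (by linarith) hheavy).trans
      (add_le_add_left ((failProb_mono _ _ _ fun _ _ _ => trivial).trans hcost) _)
  rw [← ENNReal.ofReal_add (by norm_num) (by norm_num)] at hgood
  have hamplify := failProb_amplify_mem_Icc_le natCeil_amplify_nineteen_twentieths (by norm_num)
    (by norm_num) (hgood.trans (ENNReal.ofReal_le_ofReal (by norm_num))) hcost
  rw [failProb_bind_ret]
  refine (failProb_mono _ _ _ fun z c h => ⟨?_, h.2⟩).trans
    (hamplify.trans (ENNReal.ofReal_le_ofReal (by norm_num)))
  refine isApprox_div hε hε1 ?_ (lt_of_lt_of_le (by norm_num) hp') hlo hhi h.1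
  rw [NNReal.coe_sum, heavyMass, div_mul_cancel₀ _ (sum_weight_pos hW).ne']

omit [DecidableEq U] in
theorem failProb_harmonicBranch_le [Nonempty U] (hε : 0 < ε) (hε1 : ε < 1)
    (hH : (heavy w ρ θ).Nonempty) (hB : 10 ^ 5 / (ε ^ 2 * heavyFraction w ρ θ) ≤ B)
    (hfuel : B ≤ fuel) (hp' : p' < 1 / 2) (hlo : heavyMass w ρ θ ≤ (1 + ε / 6) * p') :
    failProb (rankedLaw w ρ (propDist w hW)) (rankedLaw w ρ (PMF.uniformOfFintype U))
        ((amplify (19 / 20) (harmonicEstimator fuel ε (3 * θ.weight) θ)).bind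
          fun r => .ret ((Fintype.card U : ℝ≥0∞) * r))
        (fun x c => IsApprox ε (∑ a, w a) x ∧ c ≤ 161 * (82 * B)) ≤ ENNReal.ofReal (1 / 20) := by
  have : (p' : ℝ) < 1 / 2 := by exact_mod_cast hp'
  have hp : heavyMass w ρ θ ≤ 7 / 12 := by nlinarith [p'.coe_nonneg]
  have hW₀ := sum_weight_pos hW
  have hlight : 5 / 12 * ∑ a, (w a : ℝ) ≤ Fintype.card U * θ.weight :=
    le_trans (by gcongr; linarith) (one_sub_heavyMass_mul_sum_le (ρ := ρ) hW)
  have hθ : 0 < θ.weight := NNReal.coe_pos.1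
    (pos_of_mul_pos_right ((by positivity : (0 : ℝ) < _).trans_le hlight) (Nat.cast_nonneg _))
  have hadvice : ∑ a, (w a : ℝ) ≤ Fintype.card U * (3 * θ.weight : ℝ≥0) := by
    push_cast
    linarith
  have hF := heavyFraction_pos hH
  have hB₁ : 13 * 301 / ((ε / 3) ^ 2 * heavyFraction w ρ θ) ≤ B := by
    refine le_trans ?_ hB
    rw [div_le_div_iff₀ (by positivity) (by positivity)]
    nlinarith [mul_pos (pow_pos hε 2) hF]
  have hB₂ : (135 / 2 * 301 * (3 * θ.weight : ℝ≥0) / θ.weight + 1) /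
      (ε ^ 2 * heavyFraction w ρ θ) ≤ B := by
    refine le_trans ?_ hB
    have : (135 / 2 * 301 * (3 * θ.weight : ℝ≥0) / θ.weight : ℝ) = 135 / 2 * 301 * 3 := by
      push_cast
      field_simp
    gcongr
    linarith
  have hamplify := failProb_amplify_mem_Icc_le natCeil_amplify_nineteen_twentieths (by norm_num)
    (by norm_num) (failProb_harmonicEstimator_mem_Icc_le (hW := hW) hθ hH hε hε1 hadvice
      (hB₁.trans (Nat.cast_le.2 hfuel)))
    (failProb_harmonicEstimator_cost_le (hW := hW) hθ hH hε hε1 hB₁ hfuel hB₂)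
  rw [failProb_bind_ret]
  refine (failProb_mono _ _ _ fun z c h => ⟨isApprox_natCast_mul Fintype.card_ne_zero ?_,
    h.2.trans_eq (by ring)⟩).trans (hamplify.trans (ENNReal.ofReal_le_ofReal (by norm_num)))
  rw [NNReal.coe_sum]
  exact h.1

end Branches

/-! ### `HybridEstimator` -/

section Exponents

variable {n ε : ℝ}

theorem rpow_third_mul_rpow_cube (hn : 0 ≤ n) (hε : 0 ≤ ε) :
    (n ^ (1 / 3 : ℝ) * ε ^ (2 / 3 : ℝ)) ^ 3 = n * ε ^ 2 := by
  rw [mul_pow, ← Real.rpow_mul_natCast hn, ← Real.rpow_mul_natCast hε]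
  norm_num

theorem rpow_third_div_rpow_mul_sq (hε : 0 < ε) :
    n ^ (1 / 3 : ℝ) / ε ^ (4 / 3 : ℝ) * ε ^ 2 = n ^ (1 / 3 : ℝ) * ε ^ (2 / 3 : ℝ) := by
  rw [div_mul_eq_mul_div, mul_div_assoc, ← Real.rpow_natCast ε, ← Real.rpow_sub hε]
  norm_num

theorem sq_rpow_third_div_rpow_mul (hn : 0 ≤ n) (hε : 0 < ε) :
    (n ^ (1 / 3 : ℝ) / ε ^ (4 / 3 : ℝ) * ε) ^ 2 = n ^ (2 / 3 : ℝ) / ε ^ (2 / 3 : ℝ) := by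
  rw [mul_pow, div_pow, ← Real.rpow_mul_natCast hn, ← Real.rpow_mul_natCast hε.le,
    div_mul_eq_mul_div, mul_div_assoc, ← Real.rpow_natCast ε, ← Real.rpow_sub hε,
    div_eq_mul_inv (n ^ _), ← Real.rpow_neg hε.le]
  norm_num

theorem div_rpow_third_mul_rpow (hn : 0 < n) :
    n / (n ^ (1 / 3 : ℝ) * ε ^ (2 / 3 : ℝ)) = n ^ (2 / 3 : ℝ) / ε ^ (2 / 3 : ℝ) := by
  rw [← div_div]
  nth_rewrite 1 [← Real.rpow_one n]
  rw [← Real.rpow_sub hn]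
  norm_num

theorem four_le_rpow_third_mul_rpow (hn : 0 < n) (h : 8 / √n ≤ ε) :
    4 ≤ n ^ (1 / 3 : ℝ) * ε ^ (2 / 3 : ℝ) := by
  have hε : 0 < ε := lt_of_lt_of_le (by positivity) h
  refine le_of_pow_le_pow_left₀ (n := 3) (by norm_num) (by positivity) ?_
  rw [rpow_third_mul_rpow_cube hn.le hε.le]
  rw [div_le_iff₀ (by positivity)] at h
  calc (4 : ℝ) ^ 3 = 8 ^ 2 := by norm_num
    _ ≤ (ε * √n) ^ 2 := by gcongr
    _ = n * ε ^ 2 := by rw [mul_pow, Real.sq_sqrt hn.le, mul_comm]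

end Exponents

section Hybrid

variable {U : Type*} [Fintype U] [DecidableEq U] [Nonempty U] {w : U → ℝ≥0}
  {hW : ∑ a, w a ≠ 0} {ρ : U → ℕ} {θ : Key} {ε n' : ℝ} {fuel B : ℕ}

omit [DecidableEq U] in
theorem failProb_estimate_heavyMass_le (hε : 0 < ε) (hε1 : ε < 1) (hH : (heavy w ρ θ).Nonempty)
    (hB : 10 ^ 5 / (ε ^ 2 * heavyFraction w ρ θ) ≤ B) (hfuel : B ≤ fuel) {Q : PMF (Item U)} :
    failProb (rankedLaw w ρ (propDist w hW)) Q
        (amplify (19 / 20) (bernoulliEstimator fuel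
          (Alg.propSample.bind fun a => .ret (decide (θ ≤ a.key))) (ε / 3)))
        (fun p' c => (heavyMass w ρ θ ≤ (1 + ε / 6) * p' ∧ (1 - ε / 6) * p' ≤ heavyMass w ρ θ) ∧
          c ≤ 161 * B) ≤ ENNReal.ofReal (1 / 30) := by
  have hF := heavyFraction_pos hH
  have hFp := heavyFraction_le_heavyMass (ρ := ρ) (θ := θ) hW
  have hp := hF.trans_le hFp
  have hX := isExperiment_propSample (rankedLaw w ρ (propDist w hW)) Q fun x => θ ≤ x.key
  rw [prob_propDist] at hX
  have hB' : 13 * 26 / ((ε / 3) ^ 2 * heavyMass w ρ θ) ≤ B := calc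
    13 * 26 / ((ε / 3) ^ 2 * heavyMass w ρ θ) = 3042 / (ε ^ 2 * heavyMass w ρ θ) := by
      field_simp
      norm_num
    _ ≤ 10 ^ 5 / (ε ^ 2 * heavyFraction w ρ θ) := by
      gcongr
      norm_num
    _ ≤ B := hB
  refine (failProb_mono _ _ _ fun p' c h => ?_).trans
    ((failProb_amplify_bernoulliEstimator_mem_Icc_le hX hp (heavyMass_le_one hW)
      (by linarith : 0 < ε / 3) (by linarith) natCeil_amplify_nineteen_twentieths (by norm_num)
      (by norm_num) hB' hfuel).trans (ENNReal.ofReal_le_ofReal (by norm_num)))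
  obtain ⟨⟨hlo, hhi⟩, hc⟩ := h
  have hε6 : 0 < 1 - ε / 3 / 2 := by linarith
  rw [Real.toNNReal_le_iff_le_coe, div_le_iff₀ (by positivity)] at hlo
  rw [← NNReal.coe_le_coe, Real.coe_toNNReal _ (by positivity), le_div_iff₀ hε6] at hhi
  exact ⟨⟨by linarith, by linarith⟩, hc⟩

theorem failProb_estimate_sum_le (hε : 0 < ε) (hε1 : ε < 1) (hH : (heavy w ρ θ).Nonempty)
    (hn' : 0 < n') (hheavy : ((heavy w ρ θ).card : ℝ) ≤ 2 * n')
    (hBprop : 24000 * (⌈√(24 * n') / (ε / 3)⌉₊ + 1 : ℝ) ≤ B)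
    (hBharm : 10 ^ 5 / (ε ^ 2 * heavyFraction w ρ θ) ≤ B) (hfuel : B ≤ fuel) :
    failProb (rankedLaw w ρ (propDist w hW)) (rankedLaw w ρ (PMF.uniformOfFintype U))
        ((amplify (19 / 20) (bernoulliEstimator fuel
          (Alg.propSample.bind fun a => .ret (decide (θ ≤ a.key))) (ε / 3))).bind fun p =>
        if (1 / 2 : ℝ≥0) ≤ p then
          (amplify (19 / 20) (propEstimator
            (repeatUntil (fun a : Item U => θ ≤ a.key) Alg.propSample fuel) n' (ε / 3))).bind
              fun Wθ => .ret (Wθ / (p : ℝ≥0∞))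
        else
          (amplify (19 / 20) (harmonicEstimator fuel ε (3 * θ.weight) θ)).bind fun r =>
            .ret ((Fintype.card U : ℝ≥0∞) * r))
        (fun x c => IsApprox ε (∑ a, w a) x ∧ c ≤ 161 * (83 * B)) ≤
      ENNReal.ofReal (1 / 30) + ENNReal.ofReal (1 / 20) := by
  refine failProb_bind_le _ _ _ _ _ _ (failProb_estimate_heavyMass_le hε hε1 hH hBharm hfuel)
    fun p' c hp' => ?_
  obtain ⟨⟨hlo, hhi⟩, hc⟩ := hp'
  split_ifs with hhalf
  · exact (failProb_mono _ _ _ fun z d h => ⟨h.1, by omega⟩).trans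
      (failProb_propBranch_le hε hε1 hn' hheavy hBprop hfuel hhalf hlo hhi)
  · exact (failProb_mono _ _ _ fun z d h => ⟨h.1, by omega⟩).trans
      (failProb_harmonicBranch_le hε hε1 hH hBharm hfuel (not_le.1 hhalf) hlo)

theorem natCeil_sqrt_div_add_one_le {y : ℝ} (hε : 0 < ε) (hy : 4 ≤ y) :
    (⌈√(24 * (2 * (y * ε) ^ 2)) / (ε / 3)⌉₊ + 1 : ℝ) ≤ 22 * y := by
  have hsqrt : √(24 * (2 * (y * ε) ^ 2)) ≤ 7 * (y * ε) := by
    rw [Real.sqrt_le_left (by positivity)]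
    nlinarith [sq_nonneg (y * ε)]
  calc (⌈√(24 * (2 * (y * ε) ^ 2)) / (ε / 3)⌉₊ + 1 : ℝ)
      ≤ √(24 * (2 * (y * ε) ^ 2)) / (ε / 3) + 1 + 1 := by
        gcongr
        exact (Nat.ceil_lt_add_one (by positivity)).le
    _ ≤ 7 * (y * ε) / (ε / 3) + 1 + 1 := by gcongr
    _ = 21 * y + 2 := by field_simp; ring
    _ ≤ 22 * y := by linarith

omit [DecidableEq U] in
theorem one_div_sq_mul_heavyFraction_le {x y : ℝ} (hε : 0 < ε) (hx : 0 < x) (hxy : y * ε ^ 2 = x)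
    (hheavy : Fintype.card U / (2 * x) ≤ ((heavy w ρ θ).card : ℝ)) :
    1 / (ε ^ 2 * heavyFraction w ρ θ) ≤ 2 * y := by
  have hn : (0 : ℝ) < Fintype.card U := Nat.cast_pos.2 Fintype.card_pos
  have hH : (0 : ℝ) < (heavy w ρ θ).card := lt_of_lt_of_le (by positivity) hheavy
  rw [heavyFraction, div_le_iff₀ (by positivity), mul_div_assoc', mul_div_assoc',
    one_le_div hn]
  rw [div_le_iff₀ (by positivity), ← hxy] at hheavy
  linarith

theorem failProb_hybridCore_le_of_budget (hρ : ρ.Injective) {x y : ℝ} (hε : 0 < ε) (hε1 : ε < 1)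
    (hx : (Fintype.card U : ℝ) ^ (1 / 3 : ℝ) * ε ^ (2 / 3 : ℝ) = x)
    (hy : (Fintype.card U : ℝ) ^ (1 / 3 : ℝ) / ε ^ (4 / 3 : ℝ) = y) (hx4 : 4 ≤ x)
    (hB : 10 ^ 6 * y ≤ B) (hfuel : 13364 * B ≤ fuel) :
    failProb (rankedLaw w ρ (propDist w hW)) (rankedLaw w ρ (PMF.uniformOfFintype U))
        (hybridCore fuel (Fintype.card U) ε) (fun x c => IsApprox ε (∑ a, w a) x ∧ c ≤ fuel) ≤
      ENNReal.ofReal (1 / 3) := by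
  have hn : (0 : ℝ) < Fintype.card U := Nat.cast_pos.2 Fintype.card_pos
  have hxy : y * ε ^ 2 = x := by rw [← hx, ← hy, rpow_third_div_rpow_mul_sq hε]
  have hn' : (Fintype.card U : ℝ) ^ (2 / 3 : ℝ) / ε ^ (2 / 3 : ℝ) = (y * ε) ^ 2 := by
    rw [← hy, sq_rpow_third_div_rpow_mul hn.le hε]
  have hnx : Fintype.card U / x = (y * ε) ^ 2 := by rw [← hx, div_rpow_third_mul_rpow hn, hn']
  have hx₀ : 0 < x := by linarith
  have hε2 : ε ^ 2 ≤ 1 := pow_le_one₀ hε.le hε1.le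
  have hy₀ : 0 < y := pos_of_mul_pos_left (hxy ▸ hx₀) (by positivity)
  have hx_le_y : x ≤ y := hxy ▸ mul_le_of_le_one_right hy₀.le hε2
  have hxU : 16 * x ≤ Fintype.card U := calc
    16 * x ≤ x ^ 3 := by nlinarith [mul_le_mul hx4 hx4 (by norm_num) hx₀.le]
    _ = Fintype.card U * ε ^ 2 := by rw [← hx, rpow_third_mul_rpow_cube hn.le hε.le]
    _ ≤ Fintype.card U := mul_le_of_le_one_right hn.le hε2
  have hthreshold_cost : ⌈120 * x⌉₊ ≤ B := Nat.ceil_le.2 (by linarith)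
  refine (failProb_bind_le _ _ _ _ _ _ (failProb_findThreshold_le hρ hx hx4 hxU)
    fun θ c h => (failProb_mono _ _ _ fun z d hz => ⟨hz.1, by omega⟩).trans
      (failProb_estimate_sum_le (B := B) hε hε1 ?_ ?_ ?_ ?_ ?_ (by omega))).trans ?_
  · exact Finset.card_pos.1 (Nat.cast_pos.1 (lt_of_lt_of_le (by positivity) h.1.1))
  · rw [hn']
    positivity
  · rw [hn', ← hnx]
    exact h.1.2.trans_eq (by ring)
  · rw [hn']
    linarith [natCeil_sqrt_div_add_one_le hε (hx4.trans hx_le_y)]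
  · rw [← mul_one_div]
    linarith [one_div_sq_mul_heavyFraction_le hε hx₀ hxy h.1.1]
  · rw [← ENNReal.ofReal_add (by norm_num) (by norm_num),
      ← ENNReal.ofReal_add (by norm_num) (by norm_num)]
    exact ENNReal.ofReal_le_ofReal (by norm_num)

theorem failProb_hybridCore_le (hρ : ρ.Injective) (hε : 8 / √(Fintype.card U : ℝ) ≤ ε)
    (hε1 : ε < 1) (hfuel : 2 * 10 ^ 10 *
      ((Fintype.card U : ℝ) ^ (1 / 3 : ℝ) / ε ^ (4 / 3 : ℝ)) ≤ fuel + 1) :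
    failProb (rankedLaw w ρ (propDist w hW)) (rankedLaw w ρ (PMF.uniformOfFintype U))
        (hybridCore fuel (Fintype.card U) ε) (fun x c => IsApprox ε (∑ a, w a) x ∧ c ≤ fuel) ≤
      ENNReal.ofReal (1 / 3) := by
  have hn : (0 : ℝ) < Fintype.card U := Nat.cast_pos.2 Fintype.card_pos
  have hε₀ : 0 < ε := lt_of_lt_of_le (by positivity) hε
  have hx := four_le_rpow_third_mul_rpow hn hε
  set y := (Fintype.card U : ℝ) ^ (1 / 3 : ℝ) / ε ^ (4 / 3 : ℝ) with hy
  have hy₀ : 0 ≤ y := by positivity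
  have hy4 : 4 ≤ y := hx.trans <| (rpow_third_div_rpow_mul_sq hε₀).symm.trans_le <|
    mul_le_of_le_one_right hy₀ (pow_le_one₀ hε₀.le hε1.le)
  have hB := Nat.ceil_lt_add_one (by positivity : 0 ≤ 10 ^ 6 * y)
  refine failProb_hybridCore_le_of_budget hρ hε₀ hε1 rfl hy.symm hx (Nat.le_ceil _) ?_
  rw [← Nat.cast_le (α := ℝ)]
  push_cast
  linarith

end Hybrid

end HybridSampling

theorem mainTheorem3 :
    ∃ C₀ : ℝ, 0 < C₀ ∧ ∀ C : ℝ, C₀ ≤ C →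
      ∀ (U : Type*) [Fintype U] [DecidableEq U] [Nonempty U] (w : U → ℝ≥0)
        (hW : ∑ a, w a ≠ 0) (n : ℕ) (ε : ℝ), n = Fintype.card U →
        8 / √(n : ℝ) ≤ ε → ε < 1 →
          (∀ y ∈ (HybridSampling.run w hW (HybridSampling.hybridEstimator U C n ε)).support,
            (y.2 : ℝ) ≤ C * ((n : ℝ) ^ (1 / 3 : ℝ) / ε ^ (4 / 3 : ℝ))) ∧
          (2 / 3 : ℝ≥0∞) ≤
            (HybridSampling.run w hW (HybridSampling.hybridEstimator U C n ε)).toOuterMeasure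
              {y | ∃ x : ℝ≥0∞, y.1 = some x ∧ HybridSampling.IsApprox ε (∑ a, w a) x} := by
  open HybridSampling in
  refine ⟨2 * 10 ^ 10, by norm_num, fun C hC U _ _ _ w hW n ε hn hε hε1 => ?_⟩
  subst hn
  have hε₀ : 0 < ε := lt_of_lt_of_le (by positivity) hε
  have hbudget : 2 * 10 ^ 10 * ((Fintype.card U : ℝ) ^ (1 / 3 : ℝ) / ε ^ (4 / 3 : ℝ)) ≤
      C * ((Fintype.card U : ℝ) ^ (1 / 3 : ℝ) / ε ^ (4 / 3 : ℝ)) := by gcongr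
  refine ⟨fun y hy => (Nat.le_floor_iff (le_trans (by positivity) hbudget)).1
    (run_withBudget_cost_le w hW _ _ y hy), ?_⟩
  have hfail := failProb_attachRanks_le (propDist w hW) (PMF.uniformOfFintype U) w _ _
    fun ρ hρ => failProb_hybridCore_le hρ hε hε1 (hbudget.trans (Nat.lt_floor_add_one _).le)
  calc (2 / 3 : ℝ≥0∞) = 1 - ENNReal.ofReal (1 / 3) := by
        rw [← ENNReal.ofReal_one, ← ENNReal.ofReal_sub _ (by norm_num),
          show (1 - 1 / 3 : ℝ) = 2 / 3 by norm_num, ENNReal.ofReal_div_of_pos (by norm_num)]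
        simp
    _ ≤ _ := tsub_le_iff_right.2 <|
        (run_withBudget_success_add_failProb w hW _ _ (IsApprox ε (∑ a, w a))).ge.trans
          (add_le_add_right hfail _)
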